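/- Let $\mathcal H$ be a separable infinite-dimensional complex Hilbert space and let $n$ be a natural number. For $X=(X_1,\dots,X_n)$ and $Y=(Y_1,\dots,Y_n)$ in $B(\mathcal H)^n$, regarded as row operators $\mathcal H^{(n)}\to\mathcal H$, put $XY^*:=\sum_{i=1}^n X_iY_i^*$, and let $[B(\mathcal H)^n]_1$ and $[B(\mathcal H)^n]_1^-$ be the open and closed balls given by $\|XX^*\|^{1/2}<1$ and $\|XX^*\|^{1/2}\le 1$. A map $F=(F_1,\dots,F_n):[B(\mathcal H)^n]_1\to B(\mathcal H)^n$ is called free holomorphic if for each $j$ there are scalars $a^{(j)}_\alpha\in\mathbb C$, indexed by the words $\alpha$ in $n$ letters, such that $F_j(X)=\sum_{k=0}^\infty\sum_{|\alpha|=k}a^{(j)}_\alpha X_\alpha$ with convergence in operator norm for every $X\in[B(\mathcal H)^n]_1$; here $X_\alpha=X_{i_1}\cdots X_{i_k}$ for the word $\alpha=(i_1,\dots,i_k)$. Let $\mathrm{Aut}(B(\mathcal H)^n_1)$ be the set of bijections $\Psi$ of $[B(\mathcal H)^n]_1$ onto itself such that $\Psi$ and $\Psi^{-1}$ are free holomorphic.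 For $\lambda=(\lambda_1,\dots,\lambda_n)$ in the open Euclidean unit ball $\mathbb B_n$ of $\mathbb C^n$, write $\lambda$ also for the tuple $[\lambda_1I_{\mathcal H},\dots,\lambda_nI_{\mathcal H}]$, and put $\Delta_\lambda:=(1-\|\lambda\|_2^2)^{1/2}$ and $\Delta_{\lambda^*}:=(I_n-\lambda^*\lambda)^{1/2}$ (the positive square root of the $n\times n$ matrix with entries $\delta_{ij}-\bar\lambda_i\lambda_j$). Let $$\Theta_\lambda(X):=-\lambda+\Delta_\lambda\Big(I_{\mathcal H}-\sum_{i=1}^n\bar\lambda_iX_i\Big)^{-1}[X_1,\dots,X_n]\,\Delta_{\lambda^*},\qquad \Psi_\lambda:=-\Theta_\lambda .$$ For a unitary $n\times n$ matrix $U=[u_{ij}]$ let $\Phi_U(X):=[X_1,\dots,X_n]U=\big[\sum_{i}u_{i1}X_i,\dots,\sum_i u_{in}X_i\big]$. **Theorem.** Let $\Psi\in\mathrm{Aut}(B(\mathcal H)^n_1)$. Then $\Psi^{-1}(0)=[\lambda_1I_{\mathcal H},\dots,\lambda_nI_{\mathcal H}]$ for some $\lambda\in\mathbb B_n$. The map $\Psi_\lambda$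 belongs to $\mathrm{Aut}(B(\mathcal H)^n_1)$ and $\Psi_\lambda\circ\Psi_\lambda=\mathrm{id}$, and there is a unique unitary $U$ on $\mathbb C^n$ such that $$\Psi=\Phi_U\circ\Psi_\lambda\qquad\text{on }[B(\mathcal H)^n]_1 .$$ Moreover, $\Psi$ has a norm-continuous extension to $[B(\mathcal H)^n]_1^-$ (necessarily unique, and again denoted by $\Psi$), the operators $I-X\lambda^*$ and $I-\lambda X^*$ are invertible for every $X\in[B(\mathcal H)^n]_1^-$, and $$I_{\mathcal H}-\Psi(X)\Psi(Y)^*=\Delta_\lambda(I-X\lambda^*)^{-1}(I-XY^*)(I-\lambda Y^*)^{-1}\Delta_\lambda$$ for all $X,Y\in[B(\mathcal H)^n]_1^-$. -/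

import Mathlib

open scoped MatrixOrder Topology ComplexConjugate
open Filter

/-- The value `[X₁,…,Xₙ][Y₁,…,Yₙ]^* = ∑ᵢ Xᵢ Yᵢ^*` for two row operators. -/
noncomputable def rowMulStar {H : Type*} [NormedAddCommGroup H] [InnerProductSpace ℂ H]
    [CompleteSpace H] {n : ℕ} (X Y : Fin n → (H →L[ℂ] H)) : H →L[ℂ] H :=
  ∑ i, X i * star (Y i)

/-- The open operatorial ball `[B(H)ⁿ]_γ`, consisting of all `n`-tuples of operators with
`‖X₁X₁^* + ⋯ + XₙXₙ^*‖^{1/2} < γ`. -/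
def rowBall (H : Type*) [NormedAddCommGroup H] [InnerProductSpace ℂ H] [CompleteSpace H]
    (n : ℕ) (γ : ℝ) : Set (Fin n → (H →L[ℂ] H)) :=
  {X | √‖rowMulStar X X‖ < γ}

/-- The closed operatorial ball of radius `γ`. Its topology, inherited from the product
`B(H) × ⋯ × B(H)`, is that of the operator norm of the row `[X₁,…,Xₙ]`. -/
def rowClosedBall (H : Type*) [NormedAddCommGroup H] [InnerProductSpace ℂ H] [CompleteSpace H]
    (n : ℕ) (γ : ℝ) : Set (Fin n → (H →L[ℂ] H)) :=
  {X | √‖rowMulStar X X‖ ≤ γ}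

theorem zero_mem_rowBall (H : Type*) [NormedAddCommGroup H] [InnerProductSpace ℂ H]
    [CompleteSpace H] (n : ℕ) : (0 : Fin n → (H →L[ℂ] H)) ∈ rowBall H n 1 := by
  simp [rowBall, rowMulStar]

/-- The homogeneous part `∑_{|α| = k} a_α X_α` of degree `k` of the formal power series
`∑_α a_α Z_α`; the words of length `k` are enumerated by the maps `Fin k → Fin n`. -/
noncomputable def homogeneousPart {H : Type*} [NormedAddCommGroup H] [InnerProductSpace ℂ H]
    {n : ℕ} (a : FreeMonoid (Fin n) → ℂ) (X : Fin n → (H →L[ℂ] H)) (k : ℕ) : H →L[ℂ] H :=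
  ∑ w : Fin k → Fin n,
    a (FreeMonoid.ofList (List.ofFn w)) • FreeMonoid.lift X (FreeMonoid.ofList (List.ofFn w))

/-- Free holomorphic functions `F : [B(H)ⁿ]_γ → B(H)` with scalar coefficients:
`F(X) = ∑_{k ≥ 0} ∑_{|α| = k} a_α X_α`, with convergence in the operator norm on the ball. -/
def IsFreeHolomorphic {H : Type*} [NormedAddCommGroup H] [InnerProductSpace ℂ H]
    [CompleteSpace H] {n : ℕ} {γ : ℝ} (F : rowBall H n γ → (H →L[ℂ] H)) : Prop :=
  ∃ a : FreeMonoid (Fin n) → ℂ, ∀ X : rowBall H n γ,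
    Tendsto (fun N : ℕ => ∑ k ∈ Finset.range N, homogeneousPart a X.1 k) atTop (𝓝 (F X))

/-- Free holomorphic automorphisms of `[B(H)ⁿ]_1`: bijections of the ball onto itself which,
together with their inverses, have free holomorphic coordinates. -/
def IsFreeAutomorphism {H : Type*} [NormedAddCommGroup H] [InnerProductSpace ℂ H]
    [CompleteSpace H] {n : ℕ} (Ψ : Equiv.Perm (rowBall H n 1)) : Prop :=
  (∀ j, IsFreeHolomorphic (fun X => (Ψ X).1 j)) ∧
    (∀ j, IsFreeHolomorphic (fun X => (Ψ.symm X).1 j))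

/-- The tuple `[λ₁ I, …, λₙ I]`. -/
noncomputable def scalarRow (H : Type*) [NormedAddCommGroup H] [InnerProductSpace ℂ H] {n : ℕ}
    (lam : EuclideanSpace ℂ (Fin n)) : Fin n → (H →L[ℂ] H) :=
  fun i => lam i • (1 : H →L[ℂ] H)

/-- `Φ_L(X) = [X₁,…,Xₙ] L`, for an `n × n` scalar matrix `L`. -/
noncomputable def rowMulMatrix {H : Type*} [NormedAddCommGroup H] [InnerProductSpace ℂ H] {n : ℕ}
    (L : Matrix (Fin n) (Fin n) ℂ) (X : Fin n → (H →L[ℂ] H)) : Fin n → (H →L[ℂ] H) :=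
  fun j => ∑ i, L i j • X i

/-- The scalar `Δ_λ = (1 - ‖λ‖₂²)^{1/2}`. -/
noncomputable def defectScalar {n : ℕ} (lam : EuclideanSpace ℂ (Fin n)) : ℂ :=
  ((√(1 - ‖lam‖ ^ 2) : ℝ) : ℂ)

/-- The positive square root `Δ_{λ^*} = (I - λ^* λ)^{1/2}` of an `n × n` matrix, where `λ` is the
`1 × n` row matrix, so that `λ^* λ` has the entries `conj λᵢ * λⱼ`. -/
noncomputable def defectMatrix {n : ℕ} (lam : EuclideanSpace ℂ (Fin n)) :
    Matrix (Fin n) (Fin n) ℂ :=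
  CFC.sqrt (1 - Matrix.of fun i j => conj (lam i) * lam j)

/-- The characteristic function of the strict row contraction `λ`,
`Θ_λ(X) = -λ + Δ_λ (I - ∑ᵢ conj λᵢ Xᵢ)⁻¹ [X₁,…,Xₙ] Δ_{λ^*}`. -/
noncomputable def charFun {H : Type*} [NormedAddCommGroup H] [InnerProductSpace ℂ H]
    [CompleteSpace H] {n : ℕ} (lam : EuclideanSpace ℂ (Fin n)) (X : Fin n → (H →L[ℂ] H)) :
    Fin n → (H →L[ℂ] H) :=
  fun j => -scalarRow H lam j + defectScalar lam •
    (Ring.inverse (1 - rowMulStar X (scalarRow H lam)) * rowMulMatrix (defectMatrix lam) X j)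

/-- `Ψ_λ = -Θ_λ`. -/
noncomputable def involution {H : Type*} [NormedAddCommGroup H] [InnerProductSpace ℂ H]
    [CompleteSpace H] {n : ℕ} (lam : EuclideanSpace ℂ (Fin n)) (X : Fin n → (H →L[ℂ] H)) :
    Fin n → (H →L[ℂ] H) :=
  -charFun lam X

/-- `G` restricts to a norm-continuous extension of `Ψ` to the closed unit ball. The values of `G`
off the closed ball play no role. -/
def IsClosedBallExtension {H : Type*} [NormedAddCommGroup H] [InnerProductSpace ℂ H]
    [CompleteSpace H] {n : ℕ} (Ψ : Equiv.Perm (rowBall H n 1))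
    (G : (Fin n → (H →L[ℂ] H)) → (Fin n → (H →L[ℂ] H))) : Prop :=
  ContinuousOn G (rowClosedBall H n 1) ∧ ∀ X : rowBall H n 1, G X.1 = (Ψ X).1

/-! ### Schwarz lemmas and Cartan's theorems on the unit ball of a normed space -/

section Cartan

open Metric Set

/-! Reading a tuple as a row operator identifies the operatorial ball with the unit ball of the
Banach space of operators from the n-fold sum of H to H, where Cartan's method for automorphisms
applies. The explicit map Ψ_λ is an involutive automorphism of this ball exchanging 0 and λ =
Ψ⁻¹(0), so Φ = Ψ ∘ Ψ_λ is an automorphism fixing 0. By Cartan's uniqueness theorem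
(`eq_id_of_norm_sub_le`) Φ commutes with the circle action, and the maximum principle then makes Φ
equal to its derivative at 0 (`eq_deriv_slice`). A free holomorphic coordinate is a limit of
noncommutative polynomials with scalar coefficients, so its derivative at a scalar point is a scalar
combination of the coordinates of the direction (`exists_deriv_comp_eq`); hence Φ is multiplication
by a scalar matrix. The Schwarz lemma for Φ and its inverse makes this multiplication isometric, and
testing on scalar rows shows that the matrix is unitary.

Holomorphy is only ever used along curves. Free holomorphy assumes mere pointwise convergence;
Cauchy estimates on slices (`norm_homogeneousPart_le`) upgrade it to locally uniform convergence
along curves, which allows differentiation term by term.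

The algebra of Ψ_λ rests on the closed form Δ_{λ*} = I - (1 + Δ_λ)⁻¹ λ*λ (`defectMatrix_eq`). It
gives Ψ_λ(X) = (I - Xλ*)⁻¹ N(X) with N affine in X, and expanding N(X)N(Y)* yields the kernel
identity (`one_sub_rowMulStar_involution`), from which invariance of the ball also follows. Since
‖Xλ*‖ ≤ ‖λ‖ < 1 on the closed ball, the formula is continuous up to the boundary. Density of the
open ball identifies every continuous extension of Ψ with it, and U cancels in Ψ(X)Ψ(Y)*. -/

theorem isLittleO_pow_of_norm_le {E : Type*} [NormedAddCommGroup E] {f : ℂ → E} {C : ℝ} {m : ℕ}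
    (h : ∀ᶠ z in 𝓝 (0 : ℂ), ‖f z‖ ≤ C * ‖z‖ ^ (m + 1)) : f =o[𝓝 0] fun z => ‖z‖ ^ m := by
  have h1 : f =O[𝓝 0] fun z => ‖z‖ ^ (m + 1) :=
    Asymptotics.IsBigO.of_bound C (by simpa using h)
  refine h1.trans_isLittleO ?_
  have : (fun z : ℂ => ‖z‖) =o[𝓝 0] fun _ => (1 : ℝ) := by
    rw [Asymptotics.isLittleO_one_iff]
    simpa using (continuous_norm.tendsto (0 : ℂ))
  simpa [pow_succ] using (Asymptotics.isBigO_refl (fun z : ℂ => ‖z‖ ^ m) (𝓝 0)).mul_isLittleO this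

variable {E : Type*} [NormedAddCommGroup E] [NormedSpace ℂ E]

/-- A map on the open unit ball of `E` is disc holomorphic if it sends holomorphic curves in the
ball to holomorphic curves. -/
def DiscHolomorphic (f : E → E) : Prop :=
  ∀ (U : Set ℂ) (γ : ℂ → E), IsOpen U → DifferentiableOn ℂ γ U → MapsTo γ U (ball 0 1) →
    DifferentiableOn ℂ (fun z => f (γ z)) U

/-- Schwarz lemma of higher order for curves on the unit disc. -/
theorem norm_le_mul_pow_of_isLittleO {f : ℂ → E} {M : ℝ} {m : ℕ}
    (hd : DifferentiableOn ℂ f (ball 0 1)) (hM : ∀ z ∈ ball (0 : ℂ) 1, ‖f z‖ ≤ M)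
    (ho : f =o[𝓝 0] fun z => ‖z‖ ^ m) {z : ℂ} (hz : z ∈ ball (0 : ℂ) 1) :
    ‖f z‖ ≤ M * ‖z‖ ^ (m + 1) := by
  have h0 : f 0 = 0 := by
    have h1 : Tendsto f (𝓝 0) (𝓝 0) := by
      have h2 : (fun z : ℂ => ‖z‖ ^ m) =O[𝓝 0] fun _ => (1 : ℝ) := by
        have : ContinuousAt (fun z : ℂ => ‖z‖ ^ m) 0 := by fun_prop
        exact this.tendsto.isBigO_one ℝ
      exact (Asymptotics.isLittleO_one_iff ℝ).1 (ho.trans_isBigO h2)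
    exact tendsto_nhds_unique
      (hd.continuousOn.continuousAt (ball_mem_nhds _ one_pos)) h1
  have := Complex.dist_le_mul_div_pow_of_mapsTo_ball_of_isLittleO (R₂ := M) (n := m) hd
    (fun w hw => by simpa [h0] using hM w hw) (by simpa [h0] using ho) hz
  simpa [h0] using this

theorem DiscHolomorphic.slice {f : E → E} (hf : DiscHolomorphic f) {u : E} (hu : ‖u‖ ≤ 1) :
    DifferentiableOn ℂ (fun z : ℂ => f (z • u)) (ball 0 1) := by
  refine hf _ _ isOpen_ball (by fun_prop) fun z hz => ?_
  rw [mem_ball_zero_iff] at hz ⊢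
  rw [norm_smul]
  nlinarith [norm_nonneg z, norm_nonneg u]

theorem exists_slice_of_mem_ball {X : E} (hX : ‖X‖ < 1) :
    ∃ u : E, ‖u‖ ≤ 1 ∧ ((‖X‖ : ℝ) : ℂ) • u = X := by
  rcases eq_or_ne X 0 with rfl | h
  · exact ⟨0, by simp⟩
  · have h' : ((‖X‖ : ℝ) : ℂ) ≠ 0 := by simpa using h
    refine ⟨((‖X‖ : ℝ) : ℂ)⁻¹ • X, ?_, by rw [smul_inv_smul₀ h']⟩
    rw [norm_smul]; simp [h]

/-- Higher order Schwarz lemma on the unit ball of a normed space. -/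
theorem norm_le_mul_norm_pow_of_slice {h : E → E} {M : ℝ} {m : ℕ}
    (hd : DiscHolomorphic h) (hM : ∀ X, ‖X‖ < 1 → ‖h X‖ ≤ M)
    (ho : ∀ u : E, ‖u‖ ≤ 1 → (fun z : ℂ => h (z • u)) =o[𝓝 0] fun z => ‖z‖ ^ m)
    {X : E} (hX : ‖X‖ < 1) : ‖h X‖ ≤ M * ‖X‖ ^ (m + 1) := by
  obtain ⟨u, hu, hXu⟩ := exists_slice_of_mem_ball hX
  have := norm_le_mul_pow_of_isLittleO (hd.slice hu) (fun z hz => hM _ ?_) (ho u hu)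
    (z := ((‖X‖ : ℝ) : ℂ)) (by simpa using hX)
  · simpa [hXu] using this
  · rw [mem_ball_zero_iff] at hz
    rw [norm_smul]
    nlinarith [norm_nonneg z, norm_nonneg u]

theorem norm_smul_le_norm_of_norm_le_one {u : E} (hu : ‖u‖ ≤ 1) (z : ℂ) : ‖z • u‖ ≤ ‖z‖ := by
  rw [norm_smul]
  exact mul_le_of_le_one_right (norm_nonneg z) hu

/-- Only the order of vanishing matters: the local constant `C` is traded for the global bound `M`.
For the iterates of a self-map this gives estimates independent of the number of iterations. -/
theorem norm_le_mul_norm_pow_of_eventually {h : E → E} {M C δ : ℝ} {m : ℕ}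
    (hd : DiscHolomorphic h) (hM : ∀ X, ‖X‖ < 1 → ‖h X‖ ≤ M) (hC : 0 ≤ C) (hδ : 0 < δ)
    (ho : ∀ X, ‖X‖ < δ → ‖h X‖ ≤ C * ‖X‖ ^ (m + 1))
    {X : E} (hX : ‖X‖ < 1) : ‖h X‖ ≤ M * ‖X‖ ^ (m + 1) := by
  refine norm_le_mul_norm_pow_of_slice hd hM (fun u hu => ?_) hX
  refine isLittleO_pow_of_norm_le (C := C) ?_
  filter_upwards [ball_mem_nhds (0 : ℂ) hδ] with z hz
  have h1 := norm_smul_le_norm_of_norm_le_one hu z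
  refine (ho _ (h1.trans_lt (by simpa using hz))).trans ?_
  gcongr

theorem DiscHolomorphic.norm_le_norm {f : E → E} (hf : DiscHolomorphic f)
    (hB : ∀ X, ‖X‖ < 1 → ‖f X‖ < 1) (h0 : f 0 = 0) {X : E} (hX : ‖X‖ < 1) : ‖f X‖ ≤ ‖X‖ := by
  have := norm_le_mul_norm_pow_of_slice (m := 0) hf (fun X hX => (hB X hX).le) (fun u hu => ?_) hX
  · simpa using this
  · have h1 : ContinuousAt (fun z : ℂ => f (z • u)) 0 :=
      (hf.slice hu).continuousOn.continuousAt (ball_mem_nhds _ one_pos)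
    simp only [pow_zero, Asymptotics.isLittleO_one_iff]
    simpa [ContinuousAt, h0] using h1

/-- A Lipschitz estimate for disc holomorphic maps. -/
theorem DiscHolomorphic.norm_sub_le {h : E → E} (hd : DiscHolomorphic h) {r K : ℝ}
    (hr : 2 * r ≤ 1) (hK : ∀ X, ‖X‖ < 2 * r → ‖h X‖ ≤ K) {X Y : E} (hX : ‖X‖ ≤ r)
    (hXY : ‖Y - X‖ < r) : ‖h Y - h X‖ ≤ 2 * K * ‖Y - X‖ / r := by
  have hr0 : 0 < r := (norm_nonneg _).trans_lt hXY
  rcases eq_or_ne Y X with rfl | hne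
  · simp
  have hpos : 0 < ‖Y - X‖ := norm_pos_iff.2 (sub_ne_zero.2 hne)
  -- The complex line through X and Y stays in the larger ball for t in this disc; Schwarz on it is
  -- evaluated at t = 1.
  have hb : ∀ t ∈ ball (0 : ℂ) (r / ‖Y - X‖), ‖X + t • (Y - X)‖ < 2 * r := by
    intro t ht
    rw [mem_ball_zero_iff, lt_div_iff₀ hpos] at ht
    calc _ ≤ ‖X‖ + ‖t • (Y - X)‖ := norm_add_le _ _
      _ < 2 * r := by rw [norm_smul]; linarith
  have hX' : ‖h X‖ ≤ K := hK _ (by linarith)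
  have := Complex.dist_le_div_mul_dist_of_mapsTo_ball (R₂ := 2 * K) (z := 1)
    (hd (ball (0 : ℂ) (r / ‖Y - X‖)) (fun t => X + t • (Y - X)) isOpen_ball (by fun_prop)
      fun t ht => by simpa using (hb t ht).trans_le hr)
    (fun t ht => by
      simp only [zero_smul, add_zero, mem_closedBall, dist_eq_norm]
      exact (_root_.norm_sub_le _ _).trans (by linarith [hK _ (hb t ht)]))
    (by simpa [lt_div_iff₀ hpos] using hXY)
  simp only [one_smul, add_sub_cancel, zero_smul, add_zero, dist_eq_norm, sub_zero, norm_one,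
    mul_one] at this
  refine this.trans_eq ?_
  field_simp

theorem DiscHolomorphic.iterate {g : E → E} (hg : DiscHolomorphic g)
    (hB : ∀ X, ‖X‖ < 1 → ‖g X‖ < 1) (k : ℕ) :
    DiscHolomorphic (g^[k]) ∧ ∀ X, ‖X‖ < 1 → ‖g^[k] X‖ < 1 := by
  induction k with
  | zero => exact ⟨fun U γ _ hγ _ => by simpa using hγ, fun X hX => by simpa using hX⟩
  | succ k ih =>
    refine ⟨fun U γ hU hγ hm => ?_, fun X hX => ?_⟩
    · simp only [Function.iterate_succ_apply']
      refine hg U _ hU (ih.1 U γ hU hγ hm) fun z hz => ?_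
      simpa using ih.2 _ (by simpa using hm hz)
    · rw [Function.iterate_succ_apply']
      exact hB _ (ih.2 X hX)

theorem DiscHolomorphic.sub_id {g : E → E} (hg : DiscHolomorphic g) :
    DiscHolomorphic fun X => g X - X :=
  fun U γ hU hγ hm => (hg U γ hU hγ hm).sub hγ

/-- If g = id + P + higher order terms, with P of order m + 2, then the k-th iterate is id + kP +
higher order terms. The constant may depend on k. -/
theorem exists_norm_iterate_sub_le {g : E → E} (hg : DiscHolomorphic g)
    (hB : ∀ X, ‖X‖ < 1 → ‖g X‖ < 1) (h0 : g 0 = 0) {m : ℕ}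
    (hm : ∀ X, ‖X‖ < 1 → ‖g X - X‖ ≤ 2 * ‖X‖ ^ (m + 2)) (k : ℕ) :
    ∃ C : ℝ, 0 ≤ C ∧ ∀ X, ‖X‖ < 1 / 6 →
      ‖g^[k] X - X - (k : ℂ) • (g X - X)‖ ≤ C * ‖X‖ ^ (m + 3) := by
  induction k with
  | zero => exact ⟨0, le_rfl, fun X _ => by simp⟩
  | succ k ih =>
    obtain ⟨C, hC, h⟩ := ih
    refine ⟨C + 4 * 6 ^ (m + 2) * (2 * k + C) / 3, by positivity, fun X hX => ?_⟩
    have hX1 : ‖X‖ < 1 := by linarith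
    set Y := g^[k] X with hY
    rw [Function.iterate_succ_apply', ← hY]
    rcases eq_or_ne X 0 with rfl | hne
    · have : Y = 0 := Function.iterate_fixed h0 k
      simp [this, h0]
    have hpos : 0 < ‖X‖ := norm_pos_iff.2 hne
    have hit := hg.iterate hB k
    have hYX : ‖Y‖ ≤ ‖X‖ := hit.1.norm_le_norm hit.2 (Function.iterate_fixed h0 k) hX1
    have h1 : ‖Y - X‖ < 3 * ‖X‖ := by
      have := norm_sub_le Y X
      linarith
    have h2 : ‖Y - X‖ ≤ (2 * k + C) * ‖X‖ ^ 2 := by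
      have e : Y - X = (Y - X - (k : ℂ) • (g X - X)) + (k : ℂ) • (g X - X) := by abel
      have p1 : ‖X‖ ^ (m + 3) ≤ ‖X‖ ^ 2 := pow_le_pow_of_le_one hpos.le hX1.le (by omega)
      have p2 : ‖X‖ ^ (m + 2) ≤ ‖X‖ ^ 2 := pow_le_pow_of_le_one hpos.le hX1.le (by omega)
      have q1 : ‖(k : ℂ) • (g X - X)‖ ≤ k * (2 * ‖X‖ ^ 2) := by
        rw [norm_smul]
        simp only [Complex.norm_natCast]
        gcongr
        exact (hm X hX1).trans (by linarith)
      calc ‖Y - X‖ ≤ ‖Y - X - (k : ℂ) • (g X - X)‖ + ‖(k : ℂ) • (g X - X)‖ := by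
            rw [e]; simpa using norm_add_le (Y - X - (k : ℂ) • (g X - X)) ((k : ℂ) • (g X - X))
        _ ≤ C * ‖X‖ ^ 2 + k * (2 * ‖X‖ ^ 2) :=
            add_le_add ((h X hX).trans (by gcongr)) q1
        _ = _ := by ring
    -- The scale 3‖X‖ strictly exceeds ‖Y - X‖ ≤ 2‖X‖, and fitting twice this scale into the unit
    -- ball is the source of the radius 1/6. Dividing by it loses one power of ‖X‖, while ‖Y - X‖ =
    -- O(‖X‖²) gains two.
    have h3 := hg.sub_id.norm_sub_le (r := 3 * ‖X‖) (K := 2 * (6 * ‖X‖) ^ (m + 2)) (by linarith)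
      (fun Z hZ => (hm Z (by linarith)).trans (by gcongr; linarith)) (X := X) (Y := Y)
      (by linarith) h1
    have e : g Y - X - ((k + 1 : ℕ) : ℂ) • (g X - X) =
        (Y - X - (k : ℂ) • (g X - X)) + ((g Y - Y) - (g X - X)) := by
      push_cast
      rw [add_smul, one_smul]
      abel
    rw [e, add_mul]
    refine (norm_add_le _ _).trans (add_le_add (h X hX) (h3.trans ?_))
    calc 2 * (2 * (6 * ‖X‖) ^ (m + 2)) * ‖Y - X‖ / (3 * ‖X‖)
        ≤ 2 * (2 * (6 * ‖X‖) ^ (m + 2)) * ((2 * k + C) * ‖X‖ ^ 2) / (3 * ‖X‖) := by gcongr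
      _ = _ := by
        rw [mul_pow]
        field_simp
        ring

/-- Cartan's iteration argument: all iterates map the ball to itself, so their differences from the
identity satisfy one bound, although their leading terms grow like k. The leading term must
therefore vanish, which raises the order by one. -/
theorem norm_sub_id_le_pow {g : E → E} (hg : DiscHolomorphic g)
    (hB : ∀ X, ‖X‖ < 1 → ‖g X‖ < 1) (h0 : g 0 = 0)
    (h2 : ∀ X, ‖X‖ < 1 → ‖g X - X‖ ≤ 2 * ‖X‖ ^ 2) (m : ℕ) :
    ∀ X, ‖X‖ < 1 → ‖g X - X‖ ≤ 2 * ‖X‖ ^ (m + 2) := by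
  have hbd : ∀ {f : E → E}, (∀ X, ‖X‖ < 1 → ‖f X‖ < 1) → ∀ X, ‖X‖ < 1 → ‖f X - X‖ ≤ 2 :=
    fun hf X hX => (norm_sub_le _ _).trans (by linarith [hf X hX])
  induction m with
  | zero => exact h2
  | succ m ih =>
    intro X hX
    refine norm_le_mul_norm_pow_of_slice hg.sub_id (hbd hB) (fun u hu => ?_) hX
    rw [Asymptotics.isLittleO_iff]
    intro ε hε
    -- In 3 = 2 + 1, the 2 bounds the iterate minus the identity, uniformly in k, and the 1 absorbs
    -- the error for small z.
    obtain ⟨k, hk⟩ := exists_nat_gt (3 / ε)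
    have hk0 : (0 : ℝ) < k := (by positivity : 0 < 3 / ε).trans hk
    obtain ⟨C, hC, hk1⟩ := exists_norm_iterate_sub_le hg hB h0 ih k
    have hit := hg.iterate hB k
    have h3 : ∀ X, ‖X‖ < 1 → ‖g^[k] X - X‖ ≤ 2 * ‖X‖ ^ (m + 2) := by
      refine fun X hX => norm_le_mul_norm_pow_of_eventually (C := 2 * k + C) (δ := 1 / 6)
        hit.1.sub_id (hbd hit.2) (by positivity) (by norm_num) (fun Z hZ => ?_) hX
      have e : g^[k] Z - Z = (g^[k] Z - Z - (k : ℂ) • (g Z - Z)) + (k : ℂ) • (g Z - Z) := by abel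
      have q1 : ‖(k : ℂ) • (g Z - Z)‖ ≤ k * (2 * ‖Z‖ ^ (m + 2)) := by
        rw [norm_smul]
        simp only [Complex.norm_natCast]
        gcongr
        exact ih Z (by linarith)
      have p1 : ‖Z‖ ^ (m + 3) ≤ ‖Z‖ ^ (m + 2) :=
        pow_le_pow_of_le_one (norm_nonneg _) (by linarith) (by omega)
      have q2 : ‖g^[k] Z - Z - (k : ℂ) • (g Z - Z)‖ ≤ C * ‖Z‖ ^ (m + 2) :=
        (hk1 Z hZ).trans (by gcongr)
      rw [e]
      refine (norm_add_le _ _).trans ((add_le_add q2 q1).trans_eq (by ring))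
    have hev : ∀ᶠ z : ℂ in 𝓝 0, C * ‖z‖ < 1 := by
      have : ContinuousAt (fun z : ℂ => C * ‖z‖) 0 := by fun_prop
      exact this.eventually_lt_const (by simp)
    filter_upwards [hev, ball_mem_nhds (0 : ℂ) (show (0 : ℝ) < 1 / 6 by norm_num)] with z hz1 hz2
    have hzu := norm_smul_le_norm_of_norm_le_one hu z
    rw [mem_ball_zero_iff] at hz2
    have h4 := h3 (z • u) (by linarith)
    have h5 := hk1 (z • u) (by linarith)
    have h6 : k * ‖g (z • u) - z • u‖ ≤ 3 * ‖z‖ ^ (m + 2) := by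
      have e : (k : ℂ) • (g (z • u) - z • u) = (g^[k] (z • u) - z • u) -
        (g^[k] (z • u) - z • u - (k : ℂ) • (g (z • u) - z • u)) := by abel
      have e' : k * ‖g (z • u) - z • u‖ = ‖(k : ℂ) • (g (z • u) - z • u)‖ := by
        rw [norm_smul]; simp
      rw [e', e]
      calc _ ≤ _ := norm_sub_le _ _
        _ ≤ 2 * ‖z • u‖ ^ (m + 2) + C * ‖z • u‖ ^ (m + 3) := add_le_add h4 h5
        _ ≤ 2 * ‖z‖ ^ (m + 2) + C * ‖z‖ ^ (m + 3) := by gcongr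
        _ = 2 * ‖z‖ ^ (m + 2) + (C * ‖z‖) * ‖z‖ ^ (m + 2) := by ring
        _ ≤ 2 * ‖z‖ ^ (m + 2) + 1 * ‖z‖ ^ (m + 2) := by gcongr
        _ = _ := by ring
    have h7 : 3 ≤ ε * k := by rw [div_lt_iff₀ hε] at hk; linarith
    have h8 : (0 : ℝ) ≤ ‖z‖ ^ (m + 2) := by positivity
    rw [Real.norm_of_nonneg (by positivity)]
    by_contra! hcon
    have : k * (ε * ‖z‖ ^ (m + 2)) < k * ‖g (z • u) - z • u‖ := by gcongr
    nlinarith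

/-- **Cartan's uniqueness theorem** for the unit ball of a normed space. -/
theorem eq_id_of_norm_sub_le {g : E → E} (hg : DiscHolomorphic g)
    (hB : ∀ X, ‖X‖ < 1 → ‖g X‖ < 1) (h0 : g 0 = 0)
    (h2 : ∀ X, ‖X‖ < 1 → ‖g X - X‖ ≤ 2 * ‖X‖ ^ 2) {X : E} (hX : ‖X‖ < 1) : g X = X := by
  have h1 : Tendsto (fun m : ℕ => 2 * ‖X‖ ^ (m + 2)) atTop (𝓝 (2 * 0)) :=
    ((tendsto_pow_atTop_nhds_zero_of_lt_one (norm_nonneg X) hX).comp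
      (tendsto_add_atTop_nat 2)).const_mul 2
  have h3 := ge_of_tendsto' h1 fun m => norm_sub_id_le_pow hg hB h0 h2 m X hX
  rw [mul_zero, norm_le_zero_iff, sub_eq_zero] at h3
  exact h3

variable {Φ Φi : E → E}

theorem DiscHolomorphic.smul_comp_smul {f : E → E} (hf : DiscHolomorphic f) {c d : ℂ}
    (hc : ‖c‖ = 1) : DiscHolomorphic fun X => d • f (c • X) := fun U γ hU hγ hm =>
  (hf U (fun z => c • γ z) hU (hγ.const_smul c) fun z hz => by
    simpa [norm_smul, hc] using hm hz).const_smul d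

/-- An automorphism of the unit ball fixing `0` commutes with the circle action. -/
theorem map_smul_of_norm_eq_one (hΦ : DiscHolomorphic Φ) (hΦi : DiscHolomorphic Φi)
    (hB : ∀ X, ‖X‖ < 1 → ‖Φ X‖ < 1) (hBi : ∀ X, ‖X‖ < 1 → ‖Φi X‖ < 1)
    (hl : ∀ X, ‖X‖ < 1 → Φi (Φ X) = X) (hr : ∀ X, ‖X‖ < 1 → Φ (Φi X) = X) (h0 : Φ 0 = 0)
    {c : ℂ} (hc : ‖c‖ = 1) {X : E} (hX : ‖X‖ < 1) : Φ (c • X) = c • Φ X := by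
  have hc0 : c ≠ 0 := by rintro rfl; simp at hc
  have h0i : Φi 0 = 0 := by simpa [h0] using hl 0 (by simp)
  set D : E → E := fun X => c⁻¹ • Φ (c • X) with hD
  have hDh : DiscHolomorphic D := hΦ.smul_comp_smul hc
  have hDB : ∀ X, ‖X‖ < 1 → ‖D X‖ < 1 := fun X hX => by
    simpa [hD, norm_smul, hc] using hB (c • X) (by simpa [norm_smul, hc] using hX)
  have hd2 : ∀ X, ‖X‖ < 1 → ‖D X - Φ X‖ ≤ 2 * ‖X‖ ^ 2 := by
    refine fun X hX => norm_le_mul_norm_pow_of_slice (m := 1) (h := fun X => D X - Φ X)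
      (fun U γ hU hγ hm => (hDh U γ hU hγ hm).sub (hΦ U γ hU hγ hm))
      (fun X hX => (norm_sub_le _ _).trans (by linarith [hDB X hX, hB X hX]))
      (fun u hu => ?_) hX
    have h1 : HasDerivAt (fun z : ℂ => Φ (z • u)) (deriv (fun z : ℂ => Φ (z • u)) 0) 0 :=
      ((hΦ.slice hu).differentiableAt (ball_mem_nhds _ one_pos)).hasDerivAt
    -- The factor c from the inner rotation cancels c⁻¹, so `D` and `Φ` agree to first order.
    have h2 : HasDerivAt (fun z : ℂ => D (z • u)) (deriv (fun z : ℂ => Φ (z • u)) 0) 0 := by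
      have h3 : HasDerivAt (fun z : ℂ => c * z) c 0 := by
        simpa using (hasDerivAt_id (0 : ℂ)).const_mul c
      rw [← mul_zero c] at h1
      simpa [hD, Function.comp_def, smul_smul, hc0] using (h1.scomp (0 : ℂ) h3).fun_const_smul c⁻¹
    have h4 := (h2.sub h1).isLittleO
    simpa [hD, h0, ← Asymptotics.isLittleO_norm_right (g' := fun z : ℂ => z)] using h4
  have hg : DiscHolomorphic fun X => Φi (D X) := fun U γ hU hγ hm =>
    hΦi U _ hU (hDh U γ hU hγ hm) fun z hz => by
      simpa using hDB _ (by simpa using hm hz)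
  have hgB : ∀ X, ‖X‖ < 1 → ‖Φi (D X)‖ < 1 := fun X hX => hBi _ (hDB X hX)
  have key : Φi (D X) = X := by
    refine eq_id_of_norm_sub_le hg hgB (by simp [hD, h0, h0i]) (fun X hX => ?_) hX
    -- On the ball of radius 1/2 the Lipschitz estimate for `Φi` has constant 4, which doubles to 8
    -- through ‖D Z - Φ Z‖ ≤ 2‖Z‖².
    refine norm_le_mul_norm_pow_of_eventually (C := 8) (δ := 1 / 4) (m := 1) hg.sub_id
      (fun X hX => (norm_sub_le _ _).trans (by linarith [hgB X hX])) (by norm_num) (by norm_num)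
      (fun Z hZ => ?_) hX
    have hZ1 : ‖Z‖ < 1 := by linarith
    have h3 := hd2 Z hZ1
    have h5 := hΦi.norm_sub_le (r := 1 / 2) (K := 1) (by norm_num)
      (fun W hW => (hBi W (by linarith)).le) (X := Φ Z) (Y := D Z)
      ((hΦ.norm_le_norm hB h0 hZ1).trans (by linarith)) (by nlinarith [norm_nonneg Z])
    rw [hl Z hZ1] at h5
    refine h5.trans ?_
    norm_num
    linarith
  have h6 : Φ (Φi (D X)) = D X := hr _ (hDB X hX)
  rw [key] at h6
  rw [h6, hD]
  simp [smul_smul, hc0]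

/-- **Cartan's theorem**: an automorphism of the unit ball fixing `0` agrees with its derivative
at the origin. -/
theorem eq_deriv_slice [CompleteSpace E] (hΦ : DiscHolomorphic Φ) (hΦi : DiscHolomorphic Φi)
    (hB : ∀ X, ‖X‖ < 1 → ‖Φ X‖ < 1) (hBi : ∀ X, ‖X‖ < 1 → ‖Φi X‖ < 1)
    (hl : ∀ X, ‖X‖ < 1 → Φi (Φ X) = X) (hr : ∀ X, ‖X‖ < 1 → Φ (Φi X) = X) (h0 : Φ 0 = 0)
    {X : E} (hX : ‖X‖ < 1) : Φ X = deriv (fun z : ℂ => Φ (z • X)) 0 := by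
  set f : ℂ → E := fun z => Φ (z • X) with hf
  -- The slice through X extends past the closed unit disc, so the unit circle is available as a
  -- boundary.
  obtain ⟨R, hR1, hR⟩ : ∃ R : ℝ, 1 < R ∧ R * ‖X‖ < 1 := by
    refine ⟨1 + (1 - ‖X‖) / 2, by linarith, ?_⟩
    nlinarith [norm_nonneg X]
  have hd : DifferentiableOn ℂ f (ball 0 R) := by
    refine hΦ _ _ isOpen_ball (by fun_prop) fun z hz => ?_
    rw [mem_ball_zero_iff] at hz ⊢
    rw [norm_smul]
    nlinarith [norm_nonneg X]
  have hd' : DifferentiableOn ℂ (dslope f 0) (ball 0 R) :=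
    (Complex.differentiableOn_dslope (ball_mem_nhds _ (by linarith))).2 hd
  have hcl : closure (ball (0 : ℂ) 1) ⊆ ball 0 R :=
    closure_ball_subset_closedBall.trans (closedBall_subset_ball hR1)
  -- Circle equivariance makes Φ(zX)/z constant on |z| = 1; its value at 0 is the derivative.
  have h1 := Complex.eqOn_of_eqOn_frontier (f := dslope f 0) (g := fun _ => Φ X)
    (U := ball (0 : ℂ) 1) isBounded_ball (hd'.mono hcl).diffContOnCl
    diffContOnCl_const fun z hz => ?_
  · simpa using (h1 (mem_ball_self one_pos)).symm
  · have hz1 : ‖z‖ = 1 := by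
      rw [frontier_ball (0 : ℂ) one_ne_zero] at hz
      simpa using hz
    have hz0 : z ≠ 0 := by rintro rfl; simp at hz1
    rw [dslope_of_ne _ hz0, slope_def_module]
    simp only [hf, zero_smul, h0, sub_zero]
    rw [map_smul_of_norm_eq_one hΦ hΦi hB hBi hl hr h0 hz1 hX, inv_smul_smul₀ hz0]

end Cartan

/-! ### Tuples as row operators on the Hilbert space sum -/

section RowOperator

variable {H : Type*} [NormedAddCommGroup H] [InnerProductSpace ℂ H] {n : ℕ}

/-- The Hilbert space direct sum of `n` copies of `H`. -/
def HilbertRow (H : Type*) [NormedAddCommGroup H] [InnerProductSpace ℂ H] (n : ℕ) : Type _ :=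
  PiLp 2 (fun _ : Fin n => H)

noncomputable instance : NormedAddCommGroup (HilbertRow H n) :=
  inferInstanceAs (NormedAddCommGroup (PiLp 2 (fun _ : Fin n => H)))

noncomputable instance : InnerProductSpace ℂ (HilbertRow H n) :=
  inferInstanceAs (InnerProductSpace ℂ (PiLp 2 (fun _ : Fin n => H)))

instance [CompleteSpace H] : CompleteSpace (HilbertRow H n) :=
  inferInstanceAs (CompleteSpace (PiLp 2 (fun _ : Fin n => H)))

/-- The projection of `Hⁿ` onto the `i`-th summand. -/
noncomputable def rowProj (H : Type*) [NormedAddCommGroup H] [InnerProductSpace ℂ H] (n : ℕ)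
    (i : Fin n) : HilbertRow H n →L[ℂ] H :=
  PiLp.proj 2 (fun _ : Fin n => H) i

/-- The inclusion of the `i`-th summand of `Hⁿ`. -/
noncomputable def inclusion (H : Type*) [NormedAddCommGroup H] [InnerProductSpace ℂ H] (n : ℕ)
    (i : Fin n) : H →L[ℂ] HilbertRow H n :=
  (PiLp.continuousLinearEquiv 2 ℂ (fun _ : Fin n => H)).symm.toContinuousLinearMap ∘L
    ContinuousLinearMap.single ℂ (fun _ : Fin n => H) i

theorem rowProj_inclusion_apply (i j : Fin n) (x : H) :
    rowProj H n i (inclusion H n j x) = if i = j then x else 0 := by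
  change (Pi.single j x : Fin n → H) i = _
  rw [Pi.single_apply]

theorem rowProj_comp_inclusion (i j : Fin n) :
    rowProj H n i ∘L inclusion H n j = if i = j then 1 else 0 := by
  ext x
  rw [ContinuousLinearMap.comp_apply, rowProj_inclusion_apply]
  split_ifs <;> rfl

theorem HilbertRow.ext {x y : HilbertRow H n} (h : ∀ i, rowProj H n i x = rowProj H n i y) :
    x = y :=
  PiLp.ext h

theorem sum_inclusion_comp_rowProj :
    ∑ i, inclusion H n i ∘L rowProj H n i = 1 := by
  ext1 x
  refine HilbertRow.ext fun j => ?_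
  simp [rowProj_inclusion_apply]

theorem inner_inclusion (i : Fin n) (x : H) (y : HilbertRow H n) :
    inner ℂ (inclusion H n i x) y = inner ℂ x (rowProj H n i y) := by
  have h : inner ℂ (inclusion H n i x) y =
      ∑ j, inner ℂ (rowProj H n j (inclusion H n i x)) (rowProj H n j y) :=
    PiLp.inner_apply _ _
  rw [h, Finset.sum_eq_single i]
  · simp [rowProj_inclusion_apply]
  · intro j _ hj
    simp [rowProj_inclusion_apply, hj]
  · simp

theorem norm_inclusion_apply (i : Fin n) (x : H) : ‖inclusion H n i x‖ = ‖x‖ := by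
  rw [@norm_eq_sqrt_re_inner ℂ, inner_inclusion, rowProj_inclusion_apply, if_pos rfl,
    ← @norm_eq_sqrt_re_inner ℂ]

/-- The row operator `Hⁿ → H` of a tuple of operators, as a linear isomorphism. -/
noncomputable def rowEquiv (H : Type*) [NormedAddCommGroup H] [InnerProductSpace ℂ H] (n : ℕ) :
    (Fin n → (H →L[ℂ] H)) ≃L[ℂ] (HilbertRow H n →L[ℂ] H) where
  toFun X := ∑ i, X i ∘L rowProj H n i
  invFun T i := T ∘L inclusion H n i
  map_add' X Y := by simp [ContinuousLinearMap.add_comp, Finset.sum_add_distrib]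
  map_smul' c X := by simp [ContinuousLinearMap.smul_comp, Finset.smul_sum]
  left_inv X := by
    ext1 j
    simp only [ContinuousLinearMap.finsetSum_comp, ContinuousLinearMap.comp_assoc,
      rowProj_comp_inclusion]
    rw [Finset.sum_eq_single j]
    · simp [ContinuousLinearMap.one_def]
    · intro i _ hi
      simp [hi]
    · simp
  right_inv T := by
    simp only [ContinuousLinearMap.comp_assoc, ← ContinuousLinearMap.comp_finsetSum]
    rw [sum_inclusion_comp_rowProj, ContinuousLinearMap.one_def, ContinuousLinearMap.comp_id]
  continuous_toFun := by fun_prop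
  continuous_invFun := by fun_prop

theorem rowEquiv_apply (X : Fin n → (H →L[ℂ] H)) :
    rowEquiv H n X = ∑ i, X i ∘L rowProj H n i := rfl

theorem rowEquiv_symm_apply (T : HilbertRow H n →L[ℂ] H) (i : Fin n) :
    (rowEquiv H n).symm T i = T ∘L inclusion H n i := rfl

theorem norm_le_norm_rowEquiv (X : Fin n → (H →L[ℂ] H)) (i : Fin n) :
    ‖X i‖ ≤ ‖rowEquiv H n X‖ := by
  have h1 : ‖inclusion H n i‖ ≤ 1 := by
    refine ContinuousLinearMap.opNorm_le_bound _ zero_le_one fun x => ?_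
    simp [norm_inclusion_apply]
  calc ‖X i‖ = ‖rowEquiv H n X ∘L inclusion H n i‖ := by
        rw [← rowEquiv_symm_apply, ContinuousLinearEquiv.symm_apply_apply]
    _ ≤ ‖rowEquiv H n X‖ * ‖inclusion H n i‖ := ContinuousLinearMap.opNorm_comp_le _ _
    _ ≤ ‖rowEquiv H n X‖ := mul_le_of_le_one_right (norm_nonneg _) h1

variable [CompleteSpace H]

open ContinuousLinearMap in
theorem adjoint_rowProj (i : Fin n) :
    adjoint (rowProj H n i) = inclusion H n i := by
  symm
  rw [eq_adjoint_iff]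
  intro x y
  rw [inner_inclusion]

open ContinuousLinearMap in
theorem rowEquiv_comp_adjoint (X Y : Fin n → (H →L[ℂ] H)) :
    rowEquiv H n X ∘L adjoint (rowEquiv H n Y) = rowMulStar X Y := by
  have h : ∀ j, rowProj H n j ∘L adjoint (rowEquiv H n Y) = star (Y j) := by
    intro j
    rw [star_eq_adjoint, ← (rowEquiv H n).symm_apply_apply Y, rowEquiv_symm_apply, adjoint_comp,
      ← adjoint_rowProj, adjoint_adjoint]
    simp
  rw [rowEquiv_apply X, finsetSum_comp, rowMulStar]
  simp [comp_assoc, h, mul_def]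

/-- This is the C*-identity applied to the adjoint of the row. It turns the operatorial ball into a
genuine norm ball, as the Cartan theory requires. -/
theorem norm_rowEquiv (X : Fin n → (H →L[ℂ] H)) :
    ‖rowEquiv H n X‖ = √‖rowMulStar X X‖ := by
  rw [← rowEquiv_comp_adjoint]
  have := ContinuousLinearMap.norm_adjoint_comp_self
    (ContinuousLinearMap.adjoint (rowEquiv H n X))
  rw [ContinuousLinearMap.adjoint_adjoint] at this
  rw [this, Real.sqrt_mul_self (norm_nonneg _)]
  simp

theorem mem_rowBall_iff {X : Fin n → (H →L[ℂ] H)} {γ : ℝ} :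
    X ∈ rowBall H n γ ↔ ‖rowEquiv H n X‖ < γ := by
  rw [norm_rowEquiv]; rfl

theorem mem_rowClosedBall_iff {X : Fin n → (H →L[ℂ] H)} {γ : ℝ} :
    X ∈ rowClosedBall H n γ ↔ ‖rowEquiv H n X‖ ≤ γ := by
  rw [norm_rowEquiv]; rfl

theorem norm_rowMulStar_le (X Y : Fin n → (H →L[ℂ] H)) :
    ‖rowMulStar X Y‖ ≤ ‖rowEquiv H n X‖ * ‖rowEquiv H n Y‖ := by
  rw [← rowEquiv_comp_adjoint]
  refine (ContinuousLinearMap.opNorm_comp_le _ _).trans_eq ?_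
  simp

theorem rowMulStar_scalarRow (lam mu : EuclideanSpace ℂ (Fin n)) :
    rowMulStar (scalarRow H lam) (scalarRow H mu) = inner ℂ mu lam • (1 : H →L[ℂ] H) := by
  simp [rowMulStar, scalarRow, PiLp.inner_apply, Finset.sum_smul, smul_smul, mul_comm]

theorem norm_rowEquiv_scalarRow [Nontrivial H] (lam : EuclideanSpace ℂ (Fin n)) :
    ‖rowEquiv H n (scalarRow H lam)‖ = ‖lam‖ := by
  rw [norm_rowEquiv, rowMulStar_scalarRow, inner_self_eq_norm_sq_to_K]
  simp [norm_smul]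

end RowOperator

/-! ### Algebra of the fractional linear map Ψ_λ -/

section Involution

variable {n : ℕ} {lam : EuclideanSpace ℂ (Fin n)}

theorem defectScalar_mul_self (hlam : ‖lam‖ < 1) :
    defectScalar lam * defectScalar lam = 1 - (‖lam‖ : ℂ) ^ 2 := by
  have : 0 ≤ 1 - ‖lam‖ ^ 2 := by nlinarith [norm_nonneg lam]
  rw [defectScalar, ← Complex.ofReal_mul, Real.mul_self_sqrt this]
  simp

theorem defectScalar_ne_zero (hlam : ‖lam‖ < 1) : defectScalar lam ≠ 0 := by
  have : 0 < 1 - ‖lam‖ ^ 2 := by nlinarith [norm_nonneg lam]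
  simpa [defectScalar] using (Real.sqrt_pos.2 this).ne'

theorem one_add_defectScalar_ne_zero : 1 + defectScalar lam ≠ 0 := by
  rw [defectScalar, ← Complex.ofReal_one, ← Complex.ofReal_add, Complex.ofReal_ne_zero]
  positivity

theorem conj_defectScalar : conj (defectScalar lam) = defectScalar lam := by
  simp [defectScalar]

theorem sum_mul_conj_eq_norm_sq : ∑ i, lam i * conj (lam i) = (‖lam‖ : ℂ) ^ 2 := by
  have := inner_self_eq_norm_sq_to_K (𝕜 := ℂ) lam
  rw [PiLp.inner_apply] at this
  simpa only [RCLike.inner_apply, Complex.coe_algebraMap] using this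

/-- The rank one matrix `λ^* λ`. -/
theorem rankOne_mul_self :
    (Matrix.of fun i j => conj (lam i) * lam j) * (Matrix.of fun i j => conj (lam i) * lam j) =
      ((‖lam‖ : ℂ) ^ 2) • Matrix.of fun i j => conj (lam i) * lam j := by
  ext i j
  simp only [Matrix.mul_apply, Matrix.of_apply, Matrix.smul_apply, smul_eq_mul,
    ← sum_mul_conj_eq_norm_sq, Finset.sum_mul]
  exact Finset.sum_congr rfl fun k _ => by ring

/-- The matrix M = λ*λ satisfies M² = ‖λ‖²M, so the square root lies in the span of 1 and M and its
coefficient solves a quadratic equation; uniqueness of the positive root finishes. -/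
theorem defectMatrix_eq (hlam : ‖lam‖ < 1) :
    defectMatrix lam = 1 - (1 + defectScalar lam)⁻¹ •
      Matrix.of fun i j => conj (lam i) * lam j := by
  set M : Matrix (Fin n) (Fin n) ℂ := Matrix.of fun i j => conj (lam i) * lam j with hM
  have hMM : M * M = ((‖lam‖ : ℂ) ^ 2) • M := rankOne_mul_self
  have hMs : star M = M := by
    ext i j
    simp [hM, mul_comm, Matrix.star_apply]
  have hsq (u v w : ℂ) (h : u + v - u * v * (‖lam‖ : ℂ) ^ 2 = w) :
      (1 - u • M) * (1 - v • M) = 1 - w • M := by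
    rw [← h, mul_sub, mul_one, sub_mul, one_mul, smul_mul_smul_comm, hMM]
    module
  have hp : (‖lam‖ : ℂ) ^ 2 = 1 - defectScalar lam * defectScalar lam := by
    rw [defectScalar_mul_self hlam]; ring
  have h1 := one_add_defectScalar_ne_zero (lam := lam)
  -- With r² = Δ_λ the candidate has an explicit self-adjoint square root in the same span, which
  -- certifies its positivity.
  set r : ℂ := ((√√(1 - ‖lam‖ ^ 2) : ℝ) : ℂ) with hr
  have hrr : defectScalar lam = r * r := by
    rw [hr, ← Complex.ofReal_mul, Real.mul_self_sqrt (Real.sqrt_nonneg _), defectScalar]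
  have hr1 : 1 + r ≠ 0 := by
    rw [hr, ← Complex.ofReal_one, ← Complex.ofReal_add, Complex.ofReal_ne_zero]
    positivity
  have hroot : 1 - (1 + defectScalar lam)⁻¹ • M =
      star (1 - ((1 + r) * (1 + defectScalar lam))⁻¹ • M) *
        (1 - ((1 + r) * (1 + defectScalar lam))⁻¹ • M) := by
    have hs : star (1 - ((1 + r) * (1 + defectScalar lam))⁻¹ • M) =
        1 - ((1 + r) * (1 + defectScalar lam))⁻¹ • M := by
      rw [star_sub, star_one, star_smul, hMs]
      simp [conj_defectScalar, hr]
    rw [hs, hsq]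
    rw [hp]
    rw [hrr] at h1 ⊢
    have h2 : 1 + r ^ 2 ≠ 0 := by rwa [sq]
    field_simp
    ring
  refine (CFC.sqrt_unique (hsq _ _ 1 ?_ |>.trans (by rw [one_smul])) ?_ : defectMatrix lam = _)
  · rw [hp]
    field_simp
    ring
  · rw [hroot]
    exact star_mul_self_nonneg _

variable {H : Type*} [NormedAddCommGroup H] [InnerProductSpace ℂ H] [CompleteSpace H]

theorem rowMulStar_scalarRow_right (X : Fin n → (H →L[ℂ] H)) :
    rowMulStar X (scalarRow H lam) = ∑ i, conj (lam i) • X i := by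
  simp [rowMulStar, scalarRow]

theorem rowMulMatrix_defectMatrix (hlam : ‖lam‖ < 1) (X : Fin n → (H →L[ℂ] H)) (j : Fin n) :
    rowMulMatrix (defectMatrix lam) X j =
      X j - ((1 + defectScalar lam)⁻¹ * lam j) • rowMulStar X (scalarRow H lam) := by
  rw [defectMatrix_eq hlam, rowMulStar_scalarRow_right]
  simp only [rowMulMatrix, Matrix.sub_apply, sub_smul, Finset.sum_sub_distrib, Matrix.one_apply,
    ite_smul, one_smul, zero_smul, Finset.sum_ite_eq', Finset.mem_univ, if_true,
    Finset.smul_sum, smul_smul, Matrix.smul_apply, Matrix.of_apply, smul_eq_mul]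
  congr 1
  exact Finset.sum_congr rfl fun i _ => by ring_nf

theorem star_rowMulStar (X Y : Fin n → (H →L[ℂ] H)) :
    star (rowMulStar X Y) = rowMulStar Y X := by
  simp [rowMulStar]

theorem rowMulStar_sub_left (X X' Y : Fin n → (H →L[ℂ] H)) :
    rowMulStar (fun j => X j - X' j) Y = rowMulStar X Y - rowMulStar X' Y := by
  simp [rowMulStar, sub_mul]

theorem rowMulStar_sub_right (X Y Y' : Fin n → (H →L[ℂ] H)) :
    rowMulStar X (fun j => Y j - Y' j) = rowMulStar X Y - rowMulStar X Y' := by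
  simp [rowMulStar, mul_sub]

theorem rowMulStar_smul_left (c : ℂ) (X Y : Fin n → (H →L[ℂ] H)) :
    rowMulStar (fun j => c • X j) Y = c • rowMulStar X Y := by
  simp [rowMulStar, Finset.smul_sum]

theorem rowMulStar_smul_right (c : ℂ) (X Y : Fin n → (H →L[ℂ] H)) :
    rowMulStar X (fun j => c • Y j) = conj c • rowMulStar X Y := by
  simp [rowMulStar, Finset.smul_sum]

theorem rowMulStar_mul_left (A : H →L[ℂ] H) (X Y : Fin n → (H →L[ℂ] H)) :
    rowMulStar (fun j => A * X j) Y = A * rowMulStar X Y := by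
  simp [rowMulStar, Finset.mul_sum, mul_assoc]

theorem rowMulStar_mul_right (A : H →L[ℂ] H) (X Y : Fin n → (H →L[ℂ] H)) :
    rowMulStar X (fun j => A * Y j) = rowMulStar X Y * star A := by
  simp [rowMulStar, Finset.sum_mul, mul_assoc]

theorem rowMulStar_scalarRow_self (hlam : ‖lam‖ < 1) :
    rowMulStar (scalarRow H lam) (scalarRow H lam) =
      (1 - defectScalar lam * defectScalar lam) • (1 : H →L[ℂ] H) := by
  rw [rowMulStar_scalarRow, inner_self_eq_norm_sq_to_K, defectScalar_mul_self hlam]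
  simp

/-- The numerator of the fractional linear map `Ψ_λ`. -/
noncomputable def involutionNumerator (lam : EuclideanSpace ℂ (Fin n))
    (X : Fin n → (H →L[ℂ] H)) (j : Fin n) : H →L[ℂ] H :=
  (1 - (1 + defectScalar lam)⁻¹ • rowMulStar X (scalarRow H lam)) * scalarRow H lam j -
    defectScalar lam • X j

theorem involution_apply (hlam : ‖lam‖ < 1) (X : Fin n → (H →L[ℂ] H)) (j : Fin n) :
    involution lam X j = lam j • 1 - defectScalar lam •
      (Ring.inverse (1 - rowMulStar X (scalarRow H lam)) *
        (X j - ((1 + defectScalar lam)⁻¹ * lam j) • rowMulStar X (scalarRow H lam))) := by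
  rw [involution, Pi.neg_apply, charFun, rowMulMatrix_defectMatrix hlam, neg_add_rev, neg_neg,
    scalarRow]
  abel

theorem involution_eq_inverse_mul (hlam : ‖lam‖ < 1) {X : Fin n → (H →L[ℂ] H)}
    (hX : IsUnit (1 - rowMulStar X (scalarRow H lam))) (j : Fin n) :
    involution lam X j =
      Ring.inverse (1 - rowMulStar X (scalarRow H lam)) * involutionNumerator lam X j := by
  have h1 := one_add_defectScalar_ne_zero (lam := lam)
  have hR := Ring.inverse_mul_cancel _ hX
  rw [involution_apply hlam, involutionNumerator, show scalarRow H lam j = lam j • 1 from rfl]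
  set B := rowMulStar X (scalarRow H lam)
  set R := Ring.inverse (1 - B)
  have hRB : R * B = R - 1 := by
    rw [mul_sub, mul_one] at hR
    rw [← hR, sub_sub_cancel]
  simp only [mul_sub, mul_smul_comm, hRB, mul_one]
  match_scalars <;> field_simp <;> ring

theorem rowMulStar_involutionNumerator_scalarRow (hlam : ‖lam‖ < 1)
    (X : Fin n → (H →L[ℂ] H)) :
    rowMulStar (involutionNumerator lam X) (scalarRow H lam) =
      (1 - rowMulStar X (scalarRow H lam)) - (defectScalar lam * defectScalar lam) • 1 := by
  have h1 := one_add_defectScalar_ne_zero (lam := lam)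
  unfold involutionNumerator
  rw [rowMulStar_sub_left, rowMulStar_mul_left, rowMulStar_smul_left,
    rowMulStar_scalarRow_self hlam, mul_smul_comm, mul_one]
  match_scalars <;> field_simp
  ring

theorem rowMulStar_involutionNumerator (hlam : ‖lam‖ < 1) (X Y : Fin n → (H →L[ℂ] H)) :
    rowMulStar (involutionNumerator lam X) (involutionNumerator lam Y) =
      (1 - rowMulStar X (scalarRow H lam)) * (1 - rowMulStar (scalarRow H lam) Y) -
        (defectScalar lam * defectScalar lam) • (1 - rowMulStar X Y) := by
  have h1 := one_add_defectScalar_ne_zero (lam := lam)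
  unfold involutionNumerator
  rw [rowMulStar_sub_left, rowMulStar_mul_left, rowMulStar_smul_left, rowMulStar_sub_right,
    rowMulStar_sub_right, rowMulStar_mul_right, rowMulStar_smul_right, rowMulStar_mul_right,
    rowMulStar_smul_right, rowMulStar_scalarRow_self hlam, star_sub, star_smul, star_one,
    star_rowMulStar, conj_defectScalar]
  set B := rowMulStar X (scalarRow H lam)
  set C := rowMulStar (scalarRow H lam) Y
  have h2 : star ((1 + defectScalar lam)⁻¹) = (1 + defectScalar lam)⁻¹ := by
    rw [star_inv₀, star_add, star_one, Complex.star_def, conj_defectScalar]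
  simp only [h2, mul_sub, sub_mul, mul_one, one_mul, mul_smul_comm, smul_mul_assoc, smul_sub]
  match_scalars <;> field_simp <;> ring

/-- The denominator at the image point is a multiple of the inverse of the denominator at X, which
is why applying Ψ_λ twice makes the resolvents cancel. -/
theorem rowMulStar_involution_scalarRow (hlam : ‖lam‖ < 1) {X : Fin n → (H →L[ℂ] H)}
    (hX : IsUnit (1 - rowMulStar X (scalarRow H lam))) :
    1 - rowMulStar (involution lam X) (scalarRow H lam) =
      (defectScalar lam * defectScalar lam) •
        Ring.inverse (1 - rowMulStar X (scalarRow H lam)) := by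
  rw [show involution lam X = _ from funext (involution_eq_inverse_mul hlam hX),
    rowMulStar_mul_left, rowMulStar_involutionNumerator_scalarRow hlam, mul_sub,
    Ring.inverse_mul_cancel _ hX, mul_smul_comm, mul_one, sub_sub_cancel]

/-- The kernel identity for `Ψ_λ`. -/
theorem one_sub_rowMulStar_involution (hlam : ‖lam‖ < 1) {X Y : Fin n → (H →L[ℂ] H)}
    (hX : IsUnit (1 - rowMulStar X (scalarRow H lam)))
    (hY : IsUnit (1 - rowMulStar Y (scalarRow H lam))) :
    1 - rowMulStar (involution lam X) (involution lam Y) =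
      (defectScalar lam * defectScalar lam) •
        (Ring.inverse (1 - rowMulStar X (scalarRow H lam)) * (1 - rowMulStar X Y) *
          Ring.inverse (1 - rowMulStar (scalarRow H lam) Y)) := by
  have hs : star (1 - rowMulStar Y (scalarRow H lam)) = 1 - rowMulStar (scalarRow H lam) Y := by
    rw [star_sub, star_one, star_rowMulStar]
  have hY' : IsUnit (1 - rowMulStar (scalarRow H lam) Y) := hs ▸ hY.star
  rw [show involution lam X = _ from funext (involution_eq_inverse_mul hlam hX),
    show involution lam Y = _ from funext (involution_eq_inverse_mul hlam hY),
    rowMulStar_mul_left, rowMulStar_mul_right, rowMulStar_involutionNumerator hlam,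
    ← Ring.inverse_star, hs, sub_mul, mul_sub, mul_assoc (1 - _), Ring.mul_inverse_cancel _ hY',
    mul_one, Ring.inverse_mul_cancel _ hX, sub_sub_cancel, smul_mul_assoc, mul_smul_comm,
    mul_assoc]

theorem involution_involution (hlam : ‖lam‖ < 1) {X : Fin n → (H →L[ℂ] H)}
    (hX : IsUnit (1 - rowMulStar X (scalarRow H lam))) :
    involution lam (involution lam X) = X := by
  have h0 := defectScalar_ne_zero hlam
  have h1 := one_add_defectScalar_ne_zero (lam := lam)
  have hB := rowMulStar_involution_scalarRow hlam hX
  have hR := Ring.mul_inverse_cancel _ hX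
  have hR' := Ring.inverse_mul_cancel _ hX
  obtain ⟨u, hu⟩ : ∃ u : (H →L[ℂ] H)ˣ,
      u.val = (defectScalar lam * defectScalar lam) •
        Ring.inverse (1 - rowMulStar X (scalarRow H lam)) ∧
      u⁻¹.val = (defectScalar lam * defectScalar lam)⁻¹ • (1 - rowMulStar X (scalarRow H lam)) :=
    ⟨⟨_, _, by rw [smul_mul_smul_comm, hR', mul_inv_cancel₀ (mul_ne_zero h0 h0), one_smul],
      by rw [smul_mul_smul_comm, hR, inv_mul_cancel₀ (mul_ne_zero h0 h0), one_smul]⟩, rfl, rfl⟩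
  have hinv : Ring.inverse (1 - rowMulStar (involution lam X) (scalarRow H lam)) =
      (defectScalar lam * defectScalar lam)⁻¹ • (1 - rowMulStar X (scalarRow H lam)) := by
    rw [hB, ← hu.1, Ring.inverse_unit, hu.2]
  have hunit : IsUnit (1 - rowMulStar (involution lam X) (scalarRow H lam)) :=
    ⟨u, by rw [hB, hu.1]⟩
  have hB' : rowMulStar (involution lam X) (scalarRow H lam) =
      1 - (defectScalar lam * defectScalar lam) •
        Ring.inverse (1 - rowMulStar X (scalarRow H lam)) := by rw [← hB]; abel
  ext1 j
  rw [involution_eq_inverse_mul hlam hunit, hinv, involutionNumerator, hB',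
    involution_eq_inverse_mul hlam hX]
  rw [involutionNumerator, show scalarRow H lam j = lam j • 1 from rfl]
  set B := rowMulStar X (scalarRow H lam)
  set R := Ring.inverse (1 - B)
  have hBR : ∀ Z, B * (R * Z) = R * Z - Z := fun Z => by
    rw [sub_mul, one_mul] at hR
    rw [← mul_assoc, show B * R = R - 1 by rw [← hR, sub_sub_cancel], sub_mul, one_mul]
  have hBR1 : B * R = R - 1 := by simpa using hBR 1
  simp only [smul_mul_assoc, sub_mul, mul_sub, mul_smul_comm, hBR, hBR1, mul_one, one_mul,
    smul_sub]
  match_scalars <;> field_simp <;> ring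

end Involution

/-! ### Ψ_λ on the open and closed balls -/

section InvolutionBall

variable {H : Type*} [NormedAddCommGroup H] [InnerProductSpace ℂ H] [CompleteSpace H]
  {n : ℕ} {lam : EuclideanSpace ℂ (Fin n)}

open ContinuousLinearMap in
theorem inner_rowMulStar_self (X : Fin n → (H →L[ℂ] H)) (h : H) :
    inner ℂ h (rowMulStar X X h) = (‖adjoint (rowEquiv H n X) h‖ : ℂ) ^ 2 := by
  rw [← rowEquiv_comp_adjoint, comp_apply, ← adjoint_inner_left]
  exact inner_self_eq_norm_sq_to_K _

variable [Nontrivial H]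

theorem norm_rowMulStar_scalarRow_lt (hlam : ‖lam‖ < 1) {X : Fin n → (H →L[ℂ] H)}
    (hX : ‖rowEquiv H n X‖ ≤ 1) : ‖rowMulStar X (scalarRow H lam)‖ < 1 := by
  refine (norm_rowMulStar_le _ _).trans_lt ?_
  rw [norm_rowEquiv_scalarRow]
  nlinarith [norm_nonneg lam]

theorem isUnit_one_sub_rowMulStar_scalarRow (hlam : ‖lam‖ < 1) {X : Fin n → (H →L[ℂ] H)}
    (hX : ‖rowEquiv H n X‖ ≤ 1) : IsUnit (1 - rowMulStar X (scalarRow H lam)) :=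
  ⟨Units.oneSub _ (norm_rowMulStar_scalarRow_lt hlam hX), rfl⟩

theorem isUnit_one_sub_scalarRow_rowMulStar (hlam : ‖lam‖ < 1) {X : Fin n → (H →L[ℂ] H)}
    (hX : ‖rowEquiv H n X‖ ≤ 1) : IsUnit (1 - rowMulStar (scalarRow H lam) X) := by
  have := (isUnit_one_sub_rowMulStar_scalarRow hlam hX).star
  rwa [star_sub, star_one, star_rowMulStar] at this

-- The kernel identity with Y = X, tested on h, reads ‖h‖² - ‖Ψ_λ(X)*h‖² = Δ_λ²(‖k‖² - ‖X*k‖²) with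
-- k = (I - λX*)⁻¹h. A gap uniform in h is needed for a strict norm bound.
open ContinuousLinearMap in
theorem norm_rowEquiv_involution_lt (hlam : ‖lam‖ < 1) {X : Fin n → (H →L[ℂ] H)}
    (hX : ‖rowEquiv H n X‖ < 1) : ‖rowEquiv H n (involution lam X)‖ < 1 := by
  have hu := isUnit_one_sub_rowMulStar_scalarRow hlam hX.le
  have hu' := isUnit_one_sub_scalarRow_rowMulStar hlam hX.le
  have hid := one_sub_rowMulStar_involution hlam hu hu
  set s : ℝ := √(1 - ‖lam‖ ^ 2) with hs
  have hs0 : 0 < s := Real.sqrt_pos.2 (by nlinarith [norm_nonneg lam])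
  have hs1 : s ≤ 1 := Real.sqrt_le_one.2 (by nlinarith [norm_nonneg lam])
  set ρ := ‖rowEquiv H n X‖ with hρ
  have hρ0 : 0 ≤ ρ := norm_nonneg _
  -- The 4 comes from squaring ‖h‖ ≤ 2‖k‖.
  set δ := s ^ 2 * (1 - ρ ^ 2) / 4 with hδ
  have hδ0 : 0 < δ := by
    have : 0 < 1 - ρ ^ 2 := by nlinarith
    positivity
  have key : ∀ h : H, ‖adjoint (rowEquiv H n (involution lam X)) h‖ ^ 2 ≤ (1 - δ) * ‖h‖ ^ 2 := by
    intro h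
    set R' := Ring.inverse (1 - rowMulStar (scalarRow H lam) X) with hR'
    have hstar : Ring.inverse (1 - rowMulStar X (scalarRow H lam)) = adjoint R' := by
      rw [← star_eq_adjoint, hR', ← Ring.inverse_star, star_sub, star_one, star_rowMulStar]
    set k := R' h with hk
    have hkh : (1 - rowMulStar (scalarRow H lam) X) k = h := by
      change ((1 - rowMulStar (scalarRow H lam) X) * R') h = h
      rw [hR', Ring.mul_inverse_cancel _ hu']
      rfl
    have h1 : ‖h‖ ≤ 2 * ‖k‖ := by
      have h2 : ‖rowMulStar (scalarRow H lam) X‖ ≤ 1 := by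
        rw [← star_rowMulStar, norm_star]
        exact (norm_rowMulStar_scalarRow_lt hlam hX.le).le
      calc ‖h‖ = ‖k - rowMulStar (scalarRow H lam) X k‖ := by rw [← hkh]; simp
        _ ≤ ‖k‖ + ‖rowMulStar (scalarRow H lam) X‖ * ‖k‖ :=
          (norm_sub_le _ _).trans (by gcongr; exact le_opNorm _ _)
        _ ≤ ‖k‖ + 1 * ‖k‖ := by gcongr
        _ = _ := by ring
    have h3 : ‖h‖ ^ 2 - ‖adjoint (rowEquiv H n (involution lam X)) h‖ ^ 2 =
        s ^ 2 * (‖k‖ ^ 2 - ‖adjoint (rowEquiv H n X) k‖ ^ 2) := by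
      have hone : ∀ x : H, (1 : H →L[ℂ] H) x = x := fun _ => rfl
      have hmul : ∀ (A B : H →L[ℂ] H) (x : H), (A * B) x = A (B x) := fun _ _ _ => rfl
      have := congrArg (fun T : H →L[ℂ] H => inner ℂ h (T h)) hid
      simp only [sub_apply, inner_sub_right, inner_rowMulStar_self, hone, smul_apply,
        inner_smul_right, hmul, hstar, adjoint_inner_right, ← hk, defectScalar,
        inner_self_eq_norm_sq_to_K] at this
      simp only [Complex.coe_algebraMap, ← hs, ← sq] at this
      exact_mod_cast this
    have h4 : ‖adjoint (rowEquiv H n X) k‖ ≤ ρ * ‖k‖ := by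
      refine (le_opNorm _ _).trans_eq ?_
      simp [hρ]
    have h5 : ‖adjoint (rowEquiv H n X) k‖ ^ 2 ≤ ρ ^ 2 * ‖k‖ ^ 2 := by
      rw [← mul_pow]; gcongr
    have h6 : ‖h‖ ^ 2 ≤ 4 * ‖k‖ ^ 2 := by nlinarith [norm_nonneg h]
    have h7 : δ * ‖h‖ ^ 2 ≤ s ^ 2 * (1 - ρ ^ 2) * ‖k‖ ^ 2 := by
      calc δ * ‖h‖ ^ 2 ≤ δ * (4 * ‖k‖ ^ 2) := by gcongr
        _ = _ := by rw [hδ]; ring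
    have h8 : s ^ 2 * ‖adjoint (rowEquiv H n X) k‖ ^ 2 ≤ s ^ 2 * (ρ ^ 2 * ‖k‖ ^ 2) := by gcongr
    nlinarith
  have hn : ‖adjoint (rowEquiv H n (involution lam X))‖ ≤ √(1 - δ) := by
    refine opNorm_le_bound _ (Real.sqrt_nonneg _) fun h => ?_
    refine abs_le_of_sq_le_sq' ?_ (by positivity) |>.2
    have hδ1 : 0 ≤ 1 - δ := by rw [hδ]; nlinarith [sq_nonneg ρ, sq_nonneg s]
    rw [mul_pow, Real.sq_sqrt hδ1]
    exact key h
  have hn' : ‖rowEquiv H n (involution lam X)‖ ≤ √(1 - δ) := by simpa using hn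
  refine hn'.trans_lt ?_
  rw [Real.sqrt_lt' one_pos]
  linarith

theorem continuousOn_involution (hlam : ‖lam‖ < 1) :
    ContinuousOn (involution (H := H) lam) (rowClosedBall H n 1) := by
  intro X hX
  refine ContinuousAt.continuousWithinAt ?_
  have hu := isUnit_one_sub_rowMulStar_scalarRow hlam (mem_rowClosedBall_iff.1 hX)
  have h1 : Continuous fun X : Fin n → (H →L[ℂ] H) => 1 - rowMulStar X (scalarRow H lam) := by
    unfold rowMulStar; fun_prop
  have h2 : ContinuousAt
      (fun X : Fin n → (H →L[ℂ] H) => Ring.inverse (1 - rowMulStar X (scalarRow H lam))) X := by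
    have h3 := NormedRing.inverse_continuousAt hu.unit
    exact ContinuousAt.comp (f := fun X : Fin n → (H →L[ℂ] H) =>
      1 - rowMulStar X (scalarRow H lam)) (by simpa using h3) h1.continuousAt
  rw [continuousAt_pi]
  intro j
  have h4 : Continuous fun X : Fin n → (H →L[ℂ] H) => rowMulMatrix (defectMatrix lam) X j := by
    unfold rowMulMatrix; fun_prop
  simp only [involution, Pi.neg_apply, charFun]
  fun_prop

end InvolutionBall

/-! ### Power series of Ψ_λ -/

section PowerSeries

variable {H : Type*} [NormedAddCommGroup H] [InnerProductSpace ℂ H] {n : ℕ}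

theorem homogeneousPart_zero (a : FreeMonoid (Fin n) → ℂ) (X : Fin n → (H →L[ℂ] H)) :
    homogeneousPart a X 0 = a 1 • 1 := by
  simp [homogeneousPart]

theorem homogeneousPart_succ (a : FreeMonoid (Fin n) → ℂ) (X : Fin n → (H →L[ℂ] H)) (k : ℕ) :
    homogeneousPart a X (k + 1) =
      ∑ i, X i * homogeneousPart (fun w => a (FreeMonoid.of i * w)) X k := by
  simp only [homogeneousPart, Finset.mul_sum]
  rw [← Finset.sum_product', Finset.univ_product_univ]
  refine (Fintype.sum_equiv (Fin.consEquiv fun _ => Fin n) _ _ fun p => ?_).symm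
  simp [Fin.consEquiv, List.ofFn_succ, FreeMonoid.ofList_cons]

/-- The coefficients of the power series of the `j`-th coordinate of `Ψ_λ`. -/
noncomputable def involutionCoeff (lam : EuclideanSpace ℂ (Fin n)) (j : Fin n) :
    List (Fin n) → ℂ
  | [] => lam j
  | [i] => -(defectScalar lam * defectMatrix lam i j)
  | i :: i' :: l => conj (lam i) * involutionCoeff lam j (i' :: l)

theorem homogeneousPart_mul_left (c : ℂ) (a : FreeMonoid (Fin n) → ℂ)
    (X : Fin n → (H →L[ℂ] H)) (k : ℕ) :
    homogeneousPart (fun w => c * a w) X k = c • homogeneousPart a X k := by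
  simp [homogeneousPart, Finset.smul_sum, smul_smul]

variable [CompleteSpace H]

/-- Summing over the first letter of a word reproduces one factor Xλ*, so the homogeneous parts of
positive degree are the terms of the Neumann series for (I - Xλ*)⁻¹. -/
theorem homogeneousPart_involutionCoeff (lam : EuclideanSpace ℂ (Fin n)) (j : Fin n)
    (X : Fin n → (H →L[ℂ] H)) (k : ℕ) :
    homogeneousPart (fun w => involutionCoeff lam j w.toList) X (k + 1) =
      rowMulStar X (scalarRow H lam) ^ k *
        (-(defectScalar lam • rowMulMatrix (defectMatrix lam) X j)) := by
  induction k with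
  | zero =>
    rw [homogeneousPart_succ]
    simp [homogeneousPart_zero, involutionCoeff, rowMulMatrix, Finset.smul_sum, smul_smul]
  | succ k ih =>
    rw [homogeneousPart_succ, pow_succ', mul_assoc, ← ih, rowMulStar_scalarRow_right,
      Finset.sum_mul]
    refine Finset.sum_congr rfl fun i _ => ?_
    rw [smul_mul_assoc, ← mul_smul_comm, ← homogeneousPart_mul_left]
    congr 1
    unfold homogeneousPart
    refine Finset.sum_congr rfl fun w _ => ?_
    congr 1
    simp [List.ofFn_succ, involutionCoeff]

theorem isFreeHolomorphic_involution [Nontrivial H] {lam : EuclideanSpace ℂ (Fin n)}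
    (hlam : ‖lam‖ < 1) (j : Fin n) :
    IsFreeHolomorphic (H := H) (γ := 1) (fun X : rowBall H n 1 => involution lam X.1 j) := by
  refine ⟨fun w => involutionCoeff lam j w.toList, fun ⟨X, hX⟩ => ?_⟩
  rw [← tendsto_add_atTop_iff_nat 1]
  simp only [Finset.sum_range_succ', homogeneousPart_involutionCoeff, ← Finset.sum_mul,
    homogeneousPart_zero]
  have h1 := (hasSum_geom_series_inverse _
    (norm_rowMulStar_scalarRow_lt hlam (mem_rowBall_iff.1 hX).le)).tendsto_sum_nat
  have h2 := (h1.mul_const (-(defectScalar lam • rowMulMatrix (defectMatrix lam) X j))).add_const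
    (lam j • (1 : H →L[ℂ] H))
  have h3 : involution lam X j = Ring.inverse (1 - rowMulStar X (scalarRow H lam)) *
      (-(defectScalar lam • rowMulMatrix (defectMatrix lam) X j)) + lam j • 1 := by
    simp [involution, charFun, scalarRow, add_comm]
  rw [h3]
  exact h2

end PowerSeries

/-! ### Cauchy estimates for vector-valued power series -/

section PowerSeriesBound

open Metric

/-- Cauchy estimate for a power series which is bounded by `1` on the unit disc. -/
theorem norm_coeff_le_one {V : Type*} [NormedAddCommGroup V] [NormedSpace ℂ V] [CompleteSpace V]
    {c : ℕ → V} {f : ℂ → V}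
    (hf : ∀ z : ℂ, ‖z‖ < 1 →
      Tendsto (fun N => ∑ k ∈ Finset.range N, z ^ k • c k) atTop (𝓝 (f z)))
    (hb : ∀ z : ℂ, ‖z‖ < 1 → ‖f z‖ ≤ 1) (k : ℕ) : ‖c k‖ ≤ 1 := by
  set p : FormalMultilinearSeries ℂ ℂ V :=
    fun k => ContinuousMultilinearMap.mkPiRing ℂ (Fin k) (c k) with hp
  have hpn : ∀ k, ‖p k‖ = ‖c k‖ := fun k => by simp [hp]
  -- Differences of consecutive partial sums tend to 0 at every point r < 1, which already bounds
  -- the radius from below.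
  have hrad : 1 ≤ p.radius := by
    refine ENNReal.le_of_forall_nnreal_lt fun r hr => ?_
    have hr1 : ‖((r : ℝ) : ℂ)‖ < 1 := by simpa using hr
    refine p.le_radius_of_tendsto (l := 0) ?_
    have h1 := hf _ hr1
    have h2 := ((h1.comp (tendsto_add_atTop_nat 1)).sub h1).norm
    simpa [Function.comp_def, Finset.sum_range_succ, norm_smul, hpn, mul_comm] using h2
  have hps := p.hasFPowerSeriesOnBall (zero_lt_one.trans_le hrad)
  have hsum : ∀ z : ℂ, ‖z‖ < 1 → p.sum z = f z := fun z hz => by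
    have h1 := (hps.hasSum (y := z) (by
      refine Metric.eball_subset_eball hrad ?_
      simpa [Metric.mem_eball, edist_zero_right, ← ofReal_norm] using hz)).tendsto_sum_nat
    simp only [zero_add] at h1
    refine tendsto_nhds_unique h1 ?_
    simpa [hp] using hf z hz
  have hR : ∀ R : ℝ, 0 < R → R < 1 → ‖c k‖ * R ^ k ≤ 1 := by
    intro R hR0 hR1
    have hd : DifferentiableOn ℂ p.sum (closure (ball 0 R)) := by
      refine hps.differentiableOn.mono fun z hz => ?_
      have := closure_ball_subset_closedBall hz
      refine Metric.eball_subset_eball hrad ?_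
      rw [mem_closedBall_zero_iff] at this
      have : ‖z‖ < 1 := by linarith
      simpa [Metric.mem_eball, edist_zero_right, ← ofReal_norm] using this
    have h1 := Complex.norm_iteratedDeriv_le_of_forall_mem_sphere_norm_le (C := 1) k hR0
      hd.diffContOnCl (fun z hz => by
        have : ‖z‖ < 1 := by rw [mem_sphere_zero_iff_norm] at hz; linarith
        rw [hsum z this]
        exact hb z this)
    have h2 := hps.factorial_smul 1 k
    rw [iteratedDeriv_eq_iteratedFDeriv, ← h2] at h1
    simp only [hp, ContinuousMultilinearMap.mkPiRing_apply, Finset.prod_const_one, one_smul,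
      mul_one, RCLike.norm_nsmul (K := ℂ), nsmul_eq_mul] at h1
    have h3 : (0 : ℝ) < k.factorial := by positivity
    rw [le_div_iff₀ (by positivity)] at h1
    nlinarith
  have hlim : Tendsto (fun R : ℝ => ‖c k‖ * R ^ k) (𝓝[<] 1) (𝓝 (‖c k‖ * 1 ^ k)) :=
    ((by fun_prop : Continuous fun R : ℝ => ‖c k‖ * R ^ k).tendsto 1).mono_left
      nhdsWithin_le_nhds
  rw [one_pow, mul_one] at hlim
  refine le_of_tendsto hlim ?_
  filter_upwards [Ioo_mem_nhdsLT (zero_lt_one' ℝ)] with R hR'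
  exact hR R hR'.1 hR'.2

end PowerSeriesBound

/-! ### Bounded free holomorphic functions along holomorphic curves -/

section FreeHolomorphicCurves

open Metric Set

variable {H : Type*} [NormedAddCommGroup H] [InnerProductSpace ℂ H] {n : ℕ}

theorem lift_smul (X : Fin n → (H →L[ℂ] H)) (z : ℂ) (w : FreeMonoid (Fin n)) :
    FreeMonoid.lift (z • X) w = z ^ w.length • FreeMonoid.lift X w := by
  induction w using FreeMonoid.inductionOn' with
  | one => simp
  | of_mul i w ih =>
    simp [ih, smul_smul, pow_add, mul_comm]

theorem homogeneousPart_smul (a : FreeMonoid (Fin n) → ℂ) (X : Fin n → (H →L[ℂ] H)) (z : ℂ)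
    (k : ℕ) : homogeneousPart a (z • X) k = z ^ k • homogeneousPart a X k := by
  simp only [homogeneousPart, lift_smul, Finset.smul_sum]
  refine Finset.sum_congr rfl fun w _ => ?_
  rw [smul_comm]
  congr 2
  simp [FreeMonoid.length]

theorem differentiableOn_homogeneousPart (a : FreeMonoid (Fin n) → ℂ) (k : ℕ) {U : Set ℂ}
    {γ : ℂ → Fin n → (H →L[ℂ] H)} (hγ : DifferentiableOn ℂ γ U) :
    DifferentiableOn ℂ (fun z => homogeneousPart a (γ z) k) U := by
  unfold homogeneousPart
  refine DifferentiableOn.fun_sum fun w _ => DifferentiableOn.fun_const_smul ?_ _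
  generalize FreeMonoid.ofList (List.ofFn w) = w
  induction w using FreeMonoid.inductionOn' with
  | one => simp
  | of_mul i w ih =>
    simp only [map_mul, FreeMonoid.lift_eval_of]
    exact ((differentiableOn_pi.1 hγ) i).mul ih

/-- First order regularity at a scalar point: the value is scalar, and the derivative along
curves through the point is a fixed scalar combination of the coordinates. -/
def HasScalarDeriv (S : (Fin n → (H →L[ℂ] H)) → (H →L[ℂ] H))
    (lam : EuclideanSpace ℂ (Fin n)) (c : Fin n → ℂ) : Prop :=
  (∃ c₀ : ℂ, S (scalarRow H lam) = c₀ • 1) ∧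
    ∀ (γ : ℂ → Fin n → (H →L[ℂ] H)) (γ' : Fin n → (H →L[ℂ] H)), HasDerivAt γ γ' 0 →
      γ 0 = scalarRow H lam → HasDerivAt (fun z => S (γ z)) (∑ i, c i • γ' i) 0

/-- In the product rule at a scalar point the undifferentiated factors are scalars and commute past
γ'. Carrying the scalar value along makes the induction on words close. -/
theorem exists_hasScalarDeriv_lift (lam : EuclideanSpace ℂ (Fin n)) (w : FreeMonoid (Fin n)) :
    ∃ c, HasScalarDeriv (H := H) (fun X => FreeMonoid.lift X w) lam c := by
  induction w using FreeMonoid.inductionOn' with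
  | one => exact ⟨0, ⟨1, by simp⟩, fun γ γ' _ _ => by simpa using hasDerivAt_const (0 : ℂ) _⟩
  | of_mul i w ih =>
    obtain ⟨c, ⟨c₀, h0⟩, h⟩ := ih
    refine ⟨fun j => lam i * c j + if j = i then c₀ else 0, ⟨lam i * c₀, ?_⟩,
      fun γ γ' hγ hγ0 => ?_⟩
    · simp [h0, scalarRow, smul_smul, mul_comm]
    · simp only [map_mul, FreeMonoid.lift_eval_of]
      have h1 := ((hasDerivAt_pi.1 hγ) i).mul (h γ γ' hγ hγ0)
      rw [hγ0, h0] at h1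
      refine h1.congr_deriv ?_
      simp [scalarRow, add_smul, Finset.sum_add_distrib, Finset.smul_sum, smul_smul, add_comm]

theorem exists_hasScalarDeriv_sum (a : FreeMonoid (Fin n) → ℂ)
    (lam : EuclideanSpace ℂ (Fin n)) (N : ℕ) :
    ∃ c, HasScalarDeriv (H := H)
      (fun X => ∑ k ∈ Finset.range N, homogeneousPart a X k) lam c := by
  choose c h0 h using exists_hasScalarDeriv_lift (H := H) (n := n) lam
  choose c₀ h0 using h0
  refine ⟨fun i => ∑ k ∈ Finset.range N, ∑ w : Fin k → Fin n,
    a (FreeMonoid.ofList (List.ofFn w)) * c (FreeMonoid.ofList (List.ofFn w)) i,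
    ⟨∑ k ∈ Finset.range N, ∑ w : Fin k → Fin n,
      a (FreeMonoid.ofList (List.ofFn w)) * c₀ (FreeMonoid.ofList (List.ofFn w)), ?_⟩,
    fun γ γ' hγ hγ0 => ?_⟩
  · simp [homogeneousPart, h0, Finset.sum_smul, smul_smul]
  · have := HasDerivAt.fun_sum (u := Finset.range N) fun k _ =>
      HasDerivAt.fun_sum (u := (Finset.univ : Finset (Fin k → Fin n))) fun w _ =>
        (h (FreeMonoid.ofList (List.ofFn w)) γ γ' hγ hγ0).fun_const_smul
          (a (FreeMonoid.ofList (List.ofFn w)))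
    refine this.congr_deriv ?_
    simp only [Finset.sum_smul, Finset.smul_sum, smul_smul]
    rw [Finset.sum_comm]
    exact Finset.sum_congr rfl fun k _ => Finset.sum_comm

variable [CompleteSpace H] {a : FreeMonoid (Fin n) → ℂ}
  {f : (Fin n → (H →L[ℂ] H)) → (H →L[ℂ] H)}

/-- The degree k part is the k-th Taylor coefficient of z ↦ f(zX), so the Cauchy estimate bounds it
by 1 on the unit ball, and homogeneity does the rest. -/
theorem norm_homogeneousPart_le
    (hf : ∀ X, ‖rowEquiv H n X‖ < 1 →
      Tendsto (fun N => ∑ k ∈ Finset.range N, homogeneousPart a X k) atTop (𝓝 (f X)))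
    (hb : ∀ X, ‖rowEquiv H n X‖ < 1 → ‖f X‖ ≤ 1) (X : Fin n → (H →L[ℂ] H)) (k : ℕ) :
    ‖homogeneousPart a X k‖ ≤ ‖rowEquiv H n X‖ ^ k := by
  have h1 : ∀ X, ‖rowEquiv H n X‖ ≤ 1 → ‖homogeneousPart a X k‖ ≤ 1 := by
    intro X hX
    have hz : ∀ z : ℂ, ‖z‖ < 1 → ‖rowEquiv H n (z • X)‖ < 1 := fun z hz => by
      rw [map_smul, norm_smul]
      nlinarith [norm_nonneg z]
    refine norm_coeff_le_one (c := homogeneousPart a X) (f := fun z => f (z • X))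
      (fun z h => ?_) (fun z h => hb _ (hz z h)) k
    simpa only [homogeneousPart_smul] using hf _ (hz z h)
  rcases eq_or_ne X 0 with rfl | hX
  · rcases Nat.eq_zero_or_pos k with rfl | hk
    · simpa using h1 0 (by simp)
    · have := homogeneousPart_smul a (0 : Fin n → (H →L[ℂ] H)) 0 k
      rw [zero_smul, zero_pow hk.ne', zero_smul] at this
      rw [this, norm_zero]
      positivity
  · set r : ℂ := ((‖rowEquiv H n X‖ : ℝ) : ℂ) with hr
    have hr0 : r ≠ 0 := by simpa [hr] using hX
    have hrn : ‖r‖ = ‖rowEquiv H n X‖ := by simp [hr]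
    have e : X = r • (r⁻¹ • X) := by rw [smul_inv_smul₀ hr0]
    rw [e, homogeneousPart_smul, ← e, norm_smul, norm_pow, hrn]
    refine mul_le_of_le_one_right (by positivity) (h1 _ ?_)
    rw [map_smul, norm_smul, norm_inv, hrn, inv_mul_cancel₀]
    rwa [← hrn, norm_ne_zero_iff]

/-- Near a point of the curve the row norm stays below some ρ < 1, and the geometric series in ρ
dominates. -/
theorem tendstoLocallyUniformlyOn_comp
    (hf : ∀ X, ‖rowEquiv H n X‖ < 1 →
      Tendsto (fun N => ∑ k ∈ Finset.range N, homogeneousPart a X k) atTop (𝓝 (f X)))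
    (hb : ∀ X, ‖rowEquiv H n X‖ < 1 → ‖f X‖ ≤ 1) {U : Set ℂ} {γ : ℂ → Fin n → (H →L[ℂ] H)}
    (hγ : ContinuousOn γ U) (hm : ∀ z ∈ U, ‖rowEquiv H n (γ z)‖ < 1) :
    TendstoLocallyUniformlyOn
      (fun N z => ∑ k ∈ Finset.range N, homogeneousPart a (γ z) k) (fun z => f (γ z)) atTop U := by
  intro V hV z hz
  obtain ⟨ρ, hρ, hρ1⟩ := exists_between (hm z hz)
  have hρ0 : 0 ≤ ρ := (norm_nonneg _).trans hρ.le
  have hc : ContinuousOn (fun z => ‖rowEquiv H n (γ z)‖) U :=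
    ((rowEquiv H n).continuous.comp_continuousOn hγ).norm
  refine ⟨{y | ‖rowEquiv H n (γ y)‖ < ρ}, (hc z hz).eventually_lt_const hρ, ?_⟩
  have hu := tendstoUniformlyOn_tsum_nat (summable_geometric_of_lt_one hρ0 hρ1)
    (f := fun k y => homogeneousPart a (γ y) k) (s := {y | ‖rowEquiv H n (γ y)‖ < ρ})
    (fun k y hy => (norm_homogeneousPart_le hf hb (γ y) k).trans
      (pow_le_pow_left₀ (norm_nonneg _) (le_of_lt hy) k))
  have hlim : ∀ y ∈ {y | ‖rowEquiv H n (γ y)‖ < ρ},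
      ∑' k, homogeneousPart a (γ y) k = f (γ y) := by
    intro y hy
    have hs : Summable fun k => homogeneousPart a (γ y) k :=
      Summable.of_norm_bounded (summable_geometric_of_lt_one hρ0 hρ1)
        (fun k => (norm_homogeneousPart_le hf hb (γ y) k).trans
          (pow_le_pow_left₀ (norm_nonneg _) (le_of_lt hy) k))
    exact tendsto_nhds_unique hs.hasSum.tendsto_sum_nat (hf _ (lt_trans hy hρ1))
  exact (hu.congr_right hlim) V hV

theorem differentiableOn_comp_of_tendsto
    (hf : ∀ X, ‖rowEquiv H n X‖ < 1 →
      Tendsto (fun N => ∑ k ∈ Finset.range N, homogeneousPart a X k) atTop (𝓝 (f X)))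
    (hb : ∀ X, ‖rowEquiv H n X‖ < 1 → ‖f X‖ ≤ 1) {U : Set ℂ} (hU : IsOpen U)
    {γ : ℂ → Fin n → (H →L[ℂ] H)} (hγ : DifferentiableOn ℂ γ U)
    (hm : ∀ z ∈ U, ‖rowEquiv H n (γ z)‖ < 1) :
    DifferentiableOn ℂ (fun z => f (γ z)) U :=
  (tendstoLocallyUniformlyOn_comp hf hb hγ.continuousOn hm).differentiableOn
    (Eventually.of_forall fun _ => DifferentiableOn.fun_sum fun k _ =>
      differentiableOn_homogeneousPart a k hγ) hU

/-- The derivative of a bounded free holomorphic function at a scalar point is given by scalars. -/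
theorem exists_deriv_comp_eq [Nontrivial H]
    (hf : ∀ X, ‖rowEquiv H n X‖ < 1 →
      Tendsto (fun N => ∑ k ∈ Finset.range N, homogeneousPart a X k) atTop (𝓝 (f X)))
    (hb : ∀ X, ‖rowEquiv H n X‖ < 1 → ‖f X‖ ≤ 1) {lam : EuclideanSpace ℂ (Fin n)}
    (hlam : ‖lam‖ < 1) :
    ∃ c : Fin n → ℂ, ∀ (U : Set ℂ) (γ : ℂ → Fin n → (H →L[ℂ] H)), IsOpen U → 0 ∈ U →
      DifferentiableOn ℂ γ U → (∀ z ∈ U, ‖rowEquiv H n (γ z)‖ < 1) → γ 0 = scalarRow H lam →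
      deriv (fun z => f (γ z)) 0 = ∑ i, c i • deriv γ 0 i := by
  choose c hc using exists_hasScalarDeriv_sum (H := H) a lam
  have key : ∀ (U : Set ℂ) (γ : ℂ → Fin n → (H →L[ℂ] H)), IsOpen U → 0 ∈ U →
      DifferentiableOn ℂ γ U → (∀ z ∈ U, ‖rowEquiv H n (γ z)‖ < 1) → γ 0 = scalarRow H lam →
      Tendsto (fun N => ∑ i, c N i • deriv γ 0 i) atTop (𝓝 (deriv (fun z => f (γ z)) 0)) := by
    intro U γ hU h0 hγ hm hγ0
    have h1 := ((tendstoLocallyUniformlyOn_comp hf hb hγ.continuousOn hm).deriv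
      (Eventually.of_forall fun _ => DifferentiableOn.fun_sum fun k _ =>
        differentiableOn_homogeneousPart a k hγ) hU).tendsto_at h0
    refine h1.congr fun N => ?_
    exact ((hc N).2 γ _ (hγ.differentiableAt (hU.mem_nhds h0)).hasDerivAt hγ0).deriv
  obtain ⟨v, hv⟩ := exists_norm_eq H zero_le_one
  -- Derivatives of partial sums converge as operators. The line through λ in direction i isolates
  -- one coefficient as a multiple of the identity, and pairing with the unit vector `v` reads it
  -- off.
  have hconv : ∀ i, ∃ d, Tendsto (fun N => c N i) atTop (𝓝 d) := by
    intro i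
    set γ : ℂ → Fin n → (H →L[ℂ] H) := fun z =>
      scalarRow H lam + z • (Pi.single i 1 : Fin n → (H →L[ℂ] H)) with hγ
    have hd : ∀ z, HasDerivAt γ (Pi.single i 1) z := fun z => by
      have h := ((hasDerivAt_id z).smul_const (Pi.single i 1 : Fin n → (H →L[ℂ] H))).const_add
        (scalarRow H lam)
      rwa [one_smul] at h
    have hcont : Continuous fun z => ‖rowEquiv H n (γ z)‖ := by fun_prop
    have h1 := key {z | ‖rowEquiv H n (γ z)‖ < 1} γ (isOpen_lt hcont continuous_const)
      (by simpa [hγ, norm_rowEquiv_scalarRow] using hlam)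
      (fun z _ => (hd z).differentiableAt.differentiableWithinAt) (fun z hz => hz) (by simp [hγ])
    rw [(hd 0).deriv] at h1
    have h2 : Continuous fun T : H →L[ℂ] H => (inner ℂ v (T v) : ℂ) := by fun_prop
    refine ⟨_, ((h2.tendsto _).comp h1).congr fun N => ?_⟩
    simp only [Function.comp_apply]
    rw [Finset.sum_eq_single i (fun j _ hj => by simp [hj]) (by simp)]
    simp [inner_self_eq_norm_sq_to_K, hv]
  choose d hd using hconv
  refine ⟨d, fun U γ hU h0 hγ hm hγ0 => tendsto_nhds_unique (key U γ hU h0 hγ hm hγ0) ?_⟩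
  exact tendsto_finsetSum _ fun i _ => (hd i).smul_const _

end FreeHolomorphicCurves

/-! ### Automorphisms of the ball and their unitary part -/

section Automorphism

open Metric Set

variable {H : Type*} [NormedAddCommGroup H] [InnerProductSpace ℂ H] {n : ℕ}

theorem rowMulMatrix_mul (L M : Matrix (Fin n) (Fin n) ℂ) (X : Fin n → (H →L[ℂ] H)) :
    rowMulMatrix (L * M) X = rowMulMatrix M (rowMulMatrix L X) := by
  ext1 j
  simp only [rowMulMatrix, Matrix.mul_apply, Finset.sum_smul, Finset.smul_sum, smul_smul]
  rw [Finset.sum_comm]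
  simp only [mul_comm]

theorem rowMulMatrix_scalarRow (L : Matrix (Fin n) (Fin n) ℂ) (mu : EuclideanSpace ℂ (Fin n)) :
    rowMulMatrix L (scalarRow H mu) = scalarRow H (Matrix.toEuclideanLin L.transpose mu) := by
  ext1 j
  simp [rowMulMatrix, scalarRow, Matrix.toLpLin_apply, Matrix.mulVec, dotProduct,
    Finset.sum_smul, smul_smul]

variable [CompleteSpace H]

open Classical in
/-- A self-map of the unit ball, extended by zero. -/
noncomputable def zeroExtend (Ψ : Equiv.Perm (rowBall H n 1)) (X : Fin n → (H →L[ℂ] H)) :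
    Fin n → (H →L[ℂ] H) :=
  if h : X ∈ rowBall H n 1 then (Ψ ⟨X, h⟩).1 else 0

theorem zeroExtend_apply (Ψ : Equiv.Perm (rowBall H n 1)) (X : rowBall H n 1) :
    zeroExtend Ψ X.1 = (Ψ X).1 := by
  rw [zeroExtend, dif_pos X.2]

theorem norm_rowEquiv_zeroExtend_lt (Ψ : Equiv.Perm (rowBall H n 1)) {X : Fin n → (H →L[ℂ] H)}
    (hX : ‖rowEquiv H n X‖ < 1) : ‖rowEquiv H n (zeroExtend Ψ X)‖ < 1 := by
  rw [zeroExtend_apply Ψ ⟨X, mem_rowBall_iff.2 hX⟩]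
  exact mem_rowBall_iff.1 (Ψ _).2

theorem zeroExtend_symm_zeroExtend (Ψ : Equiv.Perm (rowBall H n 1)) {X : Fin n → (H →L[ℂ] H)}
    (hX : ‖rowEquiv H n X‖ < 1) : zeroExtend Ψ.symm (zeroExtend Ψ X) = X := by
  rw [zeroExtend_apply Ψ ⟨X, mem_rowBall_iff.2 hX⟩, zeroExtend_apply, Equiv.symm_apply_apply]

theorem norm_zeroExtend_apply_le (Ψ : Equiv.Perm (rowBall H n 1)) (j : Fin n)
    {X : Fin n → (H →L[ℂ] H)} (hX : ‖rowEquiv H n X‖ < 1) : ‖zeroExtend Ψ X j‖ ≤ 1 :=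
  (norm_le_norm_rowEquiv _ j).trans (norm_rowEquiv_zeroExtend_lt Ψ hX).le

theorem exists_tendsto_zeroExtend {Ψ : Equiv.Perm (rowBall H n 1)} {j : Fin n}
    (hΨ : IsFreeHolomorphic fun X => (Ψ X).1 j) :
    ∃ a : FreeMonoid (Fin n) → ℂ, ∀ X, ‖rowEquiv H n X‖ < 1 →
      Tendsto (fun N => ∑ k ∈ Finset.range N, homogeneousPart a X k) atTop
        (𝓝 (zeroExtend Ψ X j)) := by
  obtain ⟨a, ha⟩ := hΨ
  refine ⟨a, fun X hX => ?_⟩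
  rw [zeroExtend_apply Ψ ⟨X, mem_rowBall_iff.2 hX⟩]
  exact ha ⟨X, mem_rowBall_iff.2 hX⟩

theorem differentiableOn_zeroExtend {Ψ : Equiv.Perm (rowBall H n 1)}
    (hΨ : ∀ j, IsFreeHolomorphic fun X => (Ψ X).1 j) {U : Set ℂ} (hU : IsOpen U)
    {γ : ℂ → Fin n → (H →L[ℂ] H)} (hγ : DifferentiableOn ℂ γ U)
    (hm : ∀ z ∈ U, ‖rowEquiv H n (γ z)‖ < 1) :
    DifferentiableOn ℂ (fun z => zeroExtend Ψ (γ z)) U := by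
  refine differentiableOn_pi.2 fun j => ?_
  obtain ⟨a, ha⟩ := exists_tendsto_zeroExtend (hΨ j)
  exact differentiableOn_comp_of_tendsto (f := fun X => zeroExtend Ψ X j) ha
    (fun X hX => norm_zeroExtend_apply_le Ψ j hX) hU hγ hm

theorem exists_deriv_zeroExtend_eq [Nontrivial H] {Ψ : Equiv.Perm (rowBall H n 1)}
    (hΨ : ∀ j, IsFreeHolomorphic fun X => (Ψ X).1 j) {lam : EuclideanSpace ℂ (Fin n)}
    (hlam : ‖lam‖ < 1) :
    ∃ C : Matrix (Fin n) (Fin n) ℂ, ∀ (U : Set ℂ) (γ : ℂ → Fin n → (H →L[ℂ] H)),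
      IsOpen U → 0 ∈ U → DifferentiableOn ℂ γ U → (∀ z ∈ U, ‖rowEquiv H n (γ z)‖ < 1) →
      γ 0 = scalarRow H lam →
      deriv (fun z => zeroExtend Ψ (γ z)) 0 = rowMulMatrix C (deriv γ 0) := by
  have h : ∀ j, ∃ c : Fin n → ℂ, ∀ (U : Set ℂ) (γ : ℂ → Fin n → (H →L[ℂ] H)),
      IsOpen U → 0 ∈ U → DifferentiableOn ℂ γ U → (∀ z ∈ U, ‖rowEquiv H n (γ z)‖ < 1) →
      γ 0 = scalarRow H lam →
      deriv (fun z => zeroExtend Ψ (γ z) j) 0 = ∑ i, c i • deriv γ 0 i := fun j => by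
    obtain ⟨a, ha⟩ := exists_tendsto_zeroExtend (hΨ j)
    exact exists_deriv_comp_eq (f := fun X => zeroExtend Ψ X j) ha
      (fun X hX => norm_zeroExtend_apply_le Ψ j hX) hlam
  choose c hc using h
  refine ⟨Matrix.of fun i j => c j i, fun U γ hU h0 hγ hm hγ0 => ?_⟩
  ext1 j
  have hd := (differentiableOn_zeroExtend hΨ hU hγ hm).differentiableAt (hU.mem_nhds h0)
  rw [deriv_pi fun j => differentiableAt_pi.1 hd j]
  beta_reduce
  rw [hc j U γ hU h0 hγ hm hγ0]
  simp [rowMulMatrix]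

theorem exists_eq_scalarRow_of_isFreeHolomorphic [Nontrivial H] {Ψ : Equiv.Perm (rowBall H n 1)}
    (hΨ : ∀ j, IsFreeHolomorphic fun X => (Ψ X).1 j) :
    ∃ lam : EuclideanSpace ℂ (Fin n), ‖lam‖ < 1 ∧
      (Ψ ⟨0, zero_mem_rowBall H n⟩).1 = scalarRow H lam := by
  choose a ha using hΨ
  have h1 : ∀ j, (Ψ ⟨0, zero_mem_rowBall H n⟩).1 j = a j 1 • 1 := fun j => by
    refine tendsto_nhds_unique (ha j ⟨0, zero_mem_rowBall H n⟩) ?_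
    rw [← tendsto_add_atTop_iff_nat 1]
    refine tendsto_const_nhds.congr fun N => ?_
    rw [Finset.sum_range_succ', homogeneousPart_zero]
    have h0 : ∀ k, homogeneousPart (a j) (0 : Fin n → (H →L[ℂ] H)) (k + 1) = 0 := fun k => by
      simp [homogeneousPart_succ]
    simp [h0]
  have h2 : (Ψ ⟨0, zero_mem_rowBall H n⟩).1 = scalarRow H (WithLp.toLp 2 fun j => a j 1) :=
    funext h1
  refine ⟨_, ?_, h2⟩
  rw [← norm_rowEquiv_scalarRow (H := H), ← h2]
  exact mem_rowBall_iff.1 (Ψ _).2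

theorem rowMulStar_rowMulMatrix {U : Matrix (Fin n) (Fin n) ℂ}
    (hU : U ∈ Matrix.unitaryGroup (Fin n) ℂ) (X Y : Fin n → (H →L[ℂ] H)) :
    rowMulStar (rowMulMatrix U X) (rowMulMatrix U Y) = rowMulStar X Y := by
  have h1 : ∀ i k, ∑ j, U i j * conj (U k j) = if i = k then 1 else 0 := fun i k => by
    have := congrFun (congrFun (Matrix.mem_unitaryGroup_iff.1 hU) i) k
    simpa [Matrix.mul_apply, Matrix.one_apply, Matrix.star_apply] using this
  simp only [rowMulStar, rowMulMatrix, star_sum, star_smul, Finset.sum_mul_sum,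
    smul_mul_smul_comm]
  rw [Finset.sum_comm]
  refine Finset.sum_congr rfl fun i _ => ?_
  rw [Finset.sum_comm]
  simp only [← Finset.sum_smul, Complex.star_def, h1]
  simp

/-- Polarization: inner products of images of basis vectors are the entries of LL*. The transpose
appears because `rowMulMatrix` multiplies rows from the right. -/
theorem mem_unitaryGroup_of_norm_map {L : Matrix (Fin n) (Fin n) ℂ}
    (hL : ∀ mu, ‖Matrix.toEuclideanLin L.transpose mu‖ = ‖mu‖) :
    L ∈ Matrix.unitaryGroup (Fin n) ℂ := by
  rw [Matrix.mem_unitaryGroup_iff]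
  ext i k
  have h := (LinearMap.norm_map_iff_inner_map_map (Matrix.toEuclideanLin L.transpose)).1 hL
    (EuclideanSpace.single k 1) (EuclideanSpace.single i 1)
  simpa [PiLp.inner_apply, Matrix.mul_apply, Matrix.one_apply, Matrix.toLpLin_apply,
    Matrix.mulVec_single, eq_comm] using h

/-- The involution `Ψ_λ` as a permutation of the ball. -/
noncomputable def involutionPerm (H : Type*) [NormedAddCommGroup H] [InnerProductSpace ℂ H]
    [CompleteSpace H] [Nontrivial H] {lam : EuclideanSpace ℂ (Fin n)} (hlam : ‖lam‖ < 1) :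
    Equiv.Perm (rowBall H n 1) :=
  have hB : ∀ X : rowBall H n 1, involution lam X.1 ∈ rowBall H n 1 := fun X =>
    mem_rowBall_iff.2 (norm_rowEquiv_involution_lt hlam (mem_rowBall_iff.1 X.2))
  have hinv : Function.Involutive fun X : rowBall H n 1 =>
      (⟨involution lam X.1, hB X⟩ : rowBall H n 1) := fun X => Subtype.ext <|
    involution_involution hlam
      (isUnit_one_sub_rowMulStar_scalarRow hlam (mem_rowBall_iff.1 X.2).le)
  hinv.toPerm

section

variable [Nontrivial H] {lam : EuclideanSpace ℂ (Fin n)}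

theorem involutionPerm_apply (hlam : ‖lam‖ < 1) (X : rowBall H n 1) :
    (involutionPerm H hlam X).1 = involution lam X.1 := rfl

theorem isFreeAutomorphism_involutionPerm (hlam : ‖lam‖ < 1) :
    IsFreeAutomorphism (involutionPerm H (n := n) hlam) :=
  ⟨isFreeHolomorphic_involution hlam, isFreeHolomorphic_involution hlam⟩

/-- A free automorphism sending `λ` to `0` is `Ψ_λ` followed by a unitary change of coordinates. -/
theorem exists_unitary_of_apply_scalarRow_eq_zero (hlam : ‖lam‖ < 1)
    {Ψ : Equiv.Perm (rowBall H n 1)}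
    (hΨ : IsFreeAutomorphism Ψ)
    (h0 : (Ψ.symm ⟨0, zero_mem_rowBall H n⟩).1 = scalarRow H lam) :
    ∃ U ∈ Matrix.unitaryGroup (Fin n) ℂ, ∀ X : rowBall H n 1,
      (Ψ X).1 = rowMulMatrix U (involution lam X.1) := by
  set e := rowEquiv H n with he
  set P := involutionPerm H (n := n) hlam with hP
  have hPf : IsFreeAutomorphism P := isFreeAutomorphism_involutionPerm hlam
  set Φ : (HilbertRow H n →L[ℂ] H) → (HilbertRow H n →L[ℂ] H) :=
    fun T => e (zeroExtend Ψ (zeroExtend P (e.symm T))) with hΦ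
  set Φi : (HilbertRow H n →L[ℂ] H) → (HilbertRow H n →L[ℂ] H) :=
    fun T => e (zeroExtend P (zeroExtend Ψ.symm (e.symm T))) with hΦi
  have hsymm : ∀ T : HilbertRow H n →L[ℂ] H, ‖T‖ < 1 → ‖e (e.symm T)‖ < 1 := by simp
  have hB : ∀ T, ‖T‖ < 1 → ‖Φ T‖ < 1 := fun T hT =>
    norm_rowEquiv_zeroExtend_lt Ψ (norm_rowEquiv_zeroExtend_lt P (hsymm T hT))
  have hBi : ∀ T, ‖T‖ < 1 → ‖Φi T‖ < 1 := fun T hT =>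
    norm_rowEquiv_zeroExtend_lt P (norm_rowEquiv_zeroExtend_lt Ψ.symm (hsymm T hT))
  have hd : DiscHolomorphic Φ := fun V γ hV hγ hm => by
    have hm' : ∀ z ∈ V, ‖e (e.symm (γ z))‖ < 1 := fun z hz => by simpa using hm hz
    have h1 : DifferentiableOn ℂ (fun z => e.symm (γ z)) V :=
      e.symm.differentiable.comp_differentiableOn hγ
    have h2 := differentiableOn_zeroExtend hPf.1 hV h1 hm'
    have h3 := differentiableOn_zeroExtend hΨ.1 hV h2 fun z hz =>
      norm_rowEquiv_zeroExtend_lt P (hm' z hz)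
    exact e.differentiable.comp_differentiableOn h3
  have hdi : DiscHolomorphic Φi := fun V γ hV hγ hm => by
    have hm' : ∀ z ∈ V, ‖e (e.symm (γ z))‖ < 1 := fun z hz => by simpa using hm hz
    have h1 : DifferentiableOn ℂ (fun z => e.symm (γ z)) V :=
      e.symm.differentiable.comp_differentiableOn hγ
    have h2 := differentiableOn_zeroExtend hΨ.2 hV h1 hm'
    have h3 := differentiableOn_zeroExtend hPf.1 hV h2 fun z hz =>
      norm_rowEquiv_zeroExtend_lt Ψ.symm (hm' z hz)
    exact e.differentiable.comp_differentiableOn h3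
  have hPP : ∀ X, ‖e X‖ < 1 → zeroExtend P (zeroExtend P X) = X := fun X hX =>
    zeroExtend_symm_zeroExtend P hX
  have hl : ∀ T, ‖T‖ < 1 → Φi (Φ T) = T := fun T hT => by
    simp only [hΦ, hΦi, ContinuousLinearEquiv.symm_apply_apply]
    rw [zeroExtend_symm_zeroExtend Ψ (norm_rowEquiv_zeroExtend_lt P (hsymm T hT)),
      hPP _ (hsymm T hT), ContinuousLinearEquiv.apply_symm_apply]
  have hr : ∀ T, ‖T‖ < 1 → Φ (Φi T) = T := fun T hT => by
    simp only [hΦ, hΦi, ContinuousLinearEquiv.symm_apply_apply]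
    rw [hPP _ (norm_rowEquiv_zeroExtend_lt Ψ.symm (hsymm T hT))]
    have := zeroExtend_symm_zeroExtend Ψ.symm (hsymm T hT)
    rw [Equiv.symm_symm] at this
    rw [this, ContinuousLinearEquiv.apply_symm_apply]
  have hP0 : zeroExtend P 0 = scalarRow H lam := by
    rw [zeroExtend_apply P ⟨0, zero_mem_rowBall H n⟩, hP, involutionPerm_apply]
    ext1 j
    simp [involution_apply hlam, rowMulStar, scalarRow]
  have hΨ0 : zeroExtend Ψ (scalarRow H lam) = 0 := by
    rw [← h0, zeroExtend_apply, Equiv.apply_symm_apply]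
  have hΦ0 : Φ 0 = 0 := by simp [hΦ, hP0, hΨ0]
  have hΦi0 : Φi 0 = 0 := by simpa [hΦ0] using hl 0 (by simp)
  obtain ⟨C, hC⟩ := exists_deriv_zeroExtend_eq hPf.1 (lam := 0) (by simp)
  obtain ⟨D, hD⟩ := exists_deriv_zeroExtend_eq hΨ.1 hlam
  -- The chain rule is applied along curves: z ↦ Ψ_λ(zX) passes through λ at z = 0, so the
  -- derivative matrices are `C` at 0 and `D` at λ.
  have hlin : ∀ X, ‖e X‖ < 1 →
      zeroExtend Ψ (zeroExtend P X) = rowMulMatrix (C * D) X := fun X hX => by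
    have h1 := eq_deriv_slice hd hdi hB hBi hl hr hΦ0 hX
    set V : Set ℂ := {z | ‖e (z • X)‖ < 1} with hVdef
    have hV : IsOpen V := isOpen_lt (by fun_prop) continuous_const
    have hV0 : (0 : ℂ) ∈ V := by simp [hVdef]
    have hγ : DifferentiableOn ℂ (fun z : ℂ => z • X) V := by fun_prop
    have hγ' : deriv (fun z : ℂ => z • X) 0 = X := by
      simpa using ((hasDerivAt_id (0 : ℂ)).smul_const X).deriv
    have h2 := differentiableOn_zeroExtend hPf.1 hV hγ fun z hz => hz
    have hm2 : ∀ z ∈ V, ‖e (zeroExtend P (z • X))‖ < 1 := fun z hz =>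
      norm_rowEquiv_zeroExtend_lt P hz
    have h3 := differentiableOn_zeroExtend hΨ.1 hV h2 hm2
    have h4 : deriv (fun z : ℂ => Φ (z • e X)) 0 =
        e (deriv (fun z : ℂ => zeroExtend Ψ (zeroExtend P (z • X))) 0) := by
      have := (e.toContinuousLinearMap.hasFDerivAt.comp_hasDerivAt (0 : ℂ)
        (h3.differentiableAt (hV.mem_nhds hV0)).hasDerivAt).deriv
      simpa [hΦ, Function.comp_def] using this
    rw [h4, hD V _ hV hV0 h2 hm2 (by simpa using hP0), hC V _ hV hV0 hγ (fun z hz => hz)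
      (by ext1; simp [scalarRow]), hγ', ← rowMulMatrix_mul] at h1
    simpa [hΦ] using h1
  -- The Schwarz lemma for `Φ` gives one inequality, and for `Φi` the other.
  have hnorm : ∀ X, ‖e X‖ < 1 → ‖e (rowMulMatrix (C * D) X)‖ = ‖e X‖ := fun X hX => by
    have h1 : Φ (e X) = e (rowMulMatrix (C * D) X) := by
      rw [← hlin X hX]; simp [hΦ]
    rw [← h1]
    refine le_antisymm (hd.norm_le_norm hB hΦ0 hX) ?_
    have := hdi.norm_le_norm hBi hΦi0 (hB _ hX)
    rwa [hl _ hX] at this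
  refine ⟨C * D, mem_unitaryGroup_of_norm_map fun mu => ?_, fun X => ?_⟩
  · have h1 : ∀ mu : EuclideanSpace ℂ (Fin n), ‖mu‖ < 1 →
        ‖Matrix.toEuclideanLin (C * D).transpose mu‖ = ‖mu‖ := fun mu hmu => by
      have := hnorm (scalarRow H mu) (by rwa [he, norm_rowEquiv_scalarRow])
      rwa [rowMulMatrix_scalarRow, he, norm_rowEquiv_scalarRow, norm_rowEquiv_scalarRow] at this
    -- Scaling by (1 + ‖mu‖)⁻¹ brings an arbitrary vector into the ball, including 0 without a case
    -- split.
    have hr0 : (0 : ℝ) < 1 + ‖mu‖ := by positivity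
    have hc : ‖(((1 + ‖mu‖)⁻¹ : ℝ) : ℂ)‖ = (1 + ‖mu‖)⁻¹ := by
      rw [Complex.norm_real, Real.norm_of_nonneg (by positivity)]
    have h2 := h1 ((((1 + ‖mu‖)⁻¹ : ℝ) : ℂ) • mu) (by
      rw [norm_smul, hc, inv_mul_lt_iff₀ hr0]; linarith)
    rw [map_smul, norm_smul, norm_smul, hc] at h2
    exact mul_left_cancel₀ (by positivity) h2
  · have hX := mem_rowBall_iff.1 X.2
    have h1 := hlin (zeroExtend P X.1) (norm_rowEquiv_zeroExtend_lt P hX)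
    rw [hPP _ hX, zeroExtend_apply, zeroExtend_apply, hP, involutionPerm_apply] at h1
    exact h1

theorem rowMulMatrix_injective_on_rowBall {L M : Matrix (Fin n) (Fin n) ℂ}
    (h : ∀ X ∈ rowBall H n 1, rowMulMatrix L X = rowMulMatrix M X) : L = M := by
  ext i j
  have h1 := congrFun (h (scalarRow H (EuclideanSpace.single i (1 / 2))) (by
    rw [mem_rowBall_iff, norm_rowEquiv_scalarRow]
    norm_num)) j
  rw [rowMulMatrix_scalarRow, rowMulMatrix_scalarRow] at h1
  obtain ⟨v, hv⟩ := exists_ne (0 : H)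
  have h2 := congrArg (fun T : H →L[ℂ] H => T v) h1
  simpa [scalarRow, Matrix.toLpLin_apply, hv] using h2

end

theorem rowClosedBall_subset_closure_rowBall :
    rowClosedBall H n 1 ⊆ closure (rowBall H n 1) := by
  intro X hX
  rw [mem_rowClosedBall_iff] at hX
  have h1 : Tendsto (fun r : ℝ => (r : ℂ) • X) (𝓝[<] 1) (𝓝 (((1 : ℝ) : ℂ) • X)) :=
    ((by fun_prop : Continuous fun r : ℝ => (r : ℂ) • X).tendsto 1).mono_left nhdsWithin_le_nhds
  rw [Complex.ofReal_one, one_smul] at h1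
  refine mem_closure_of_tendsto h1 ?_
  filter_upwards [Ioo_mem_nhdsLT (zero_lt_one' ℝ)] with r hr
  rw [mem_rowBall_iff, map_smul, norm_smul, Complex.norm_real, Real.norm_of_nonneg hr.1.le]
  nlinarith [hr.1, hr.2, norm_nonneg (rowEquiv H n X)]

theorem rowBall_subset_rowClosedBall : rowBall H n 1 ⊆ rowClosedBall H n 1 :=
  fun _ hX => mem_rowClosedBall_iff.2 (mem_rowBall_iff.1 hX).le

end Automorphism

/-! ### The structure theorem -/

theorem mainTheorem1 {H : Type*} [NormedAddCommGroup H] [InnerProductSpace ℂ H]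
    [CompleteSpace H] [TopologicalSpace.SeparableSpace H] (hH : ¬ FiniteDimensional ℂ H)
    {n : ℕ} (Ψ : Equiv.Perm (rowBall H n 1)) (hΨ : IsFreeAutomorphism Ψ) :
    ∃ lam : EuclideanSpace ℂ (Fin n),
      -- `λ := Ψ⁻¹(0)` is a point of the scalar ball
      ‖lam‖ < 1 ∧
      (Ψ.symm ⟨0, zero_mem_rowBall H n⟩).1 = scalarRow H lam ∧
      -- `Ψ_λ` is an involutive free holomorphic automorphism of the ball
      (∃ Ψlam : Equiv.Perm (rowBall H n 1), IsFreeAutomorphism Ψlam ∧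
        (∀ X, (Ψlam X).1 = involution lam X.1) ∧ (∀ X, Ψlam (Ψlam X) = X)) ∧
      -- `Ψ = Φ_U ∘ Ψ_λ` for a unique unitary `U`
      (∃! U : Matrix.unitaryGroup (Fin n) ℂ,
        ∀ X : rowBall H n 1, (Ψ X).1 = rowMulMatrix U.1 (involution lam X.1)) ∧
      -- `Ψ` extends continuously to the closed ball, where the extension satisfies the identity
      (∃ G, IsClosedBallExtension Ψ G) ∧
      (∀ X ∈ rowClosedBall H n 1, IsUnit (1 - rowMulStar X (scalarRow H lam)) ∧
        IsUnit (1 - rowMulStar (scalarRow H lam) X)) ∧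
      (∀ G, IsClosedBallExtension Ψ G → ∀ X ∈ rowClosedBall H n 1, ∀ Y ∈ rowClosedBall H n 1,
        1 - rowMulStar (G X) (G Y) =
          (defectScalar lam • 1) * Ring.inverse (1 - rowMulStar X (scalarRow H lam)) *
            (1 - rowMulStar X Y) * Ring.inverse (1 - rowMulStar (scalarRow H lam) Y) *
              (defectScalar lam • 1)) := by
  have : Nontrivial H := by
    by_contra h
    rw [not_nontrivial_iff_subsingleton] at h
    exact hH inferInstance
  obtain ⟨lam, hlam, h0⟩ := exists_eq_scalarRow_of_isFreeHolomorphic hΨ.2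
  obtain ⟨U, hU, hΨU⟩ := exists_unitary_of_apply_scalarRow_eq_zero hlam hΨ h0
  have hcont : ContinuousOn (fun X => rowMulMatrix U (involution lam X))
      (rowClosedBall H n 1) := by
    have h1 : Continuous (rowMulMatrix (H := H) U) := by
      unfold rowMulMatrix; fun_prop
    exact h1.comp_continuousOn (continuousOn_involution hlam)
  have hunit : ∀ X ∈ rowClosedBall H n 1, IsUnit (1 - rowMulStar X (scalarRow H lam)) :=
    fun X hX => isUnit_one_sub_rowMulStar_scalarRow hlam (mem_rowClosedBall_iff.1 hX)
  refine ⟨lam, hlam, h0, ⟨involutionPerm H hlam, isFreeAutomorphism_involutionPerm hlam,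
    involutionPerm_apply hlam, fun X => (involutionPerm H hlam).symm_apply_apply X⟩,
    ⟨⟨U, hU⟩, hΨU, fun V hV => Subtype.ext ?_⟩, ⟨_, hcont, fun X => (hΨU X).symm⟩,
    fun X hX => ⟨hunit X hX,
      isUnit_one_sub_scalarRow_rowMulStar hlam (mem_rowClosedBall_iff.1 hX)⟩,
    fun G hG X hX Y hY => ?_⟩
  -- Evaluating both factorizations at Ψ_λ(X) removes Ψ_λ, leaving two matrices that agree on the
  -- whole ball.
  · refine rowMulMatrix_injective_on_rowBall (H := H) fun X hX => ?_
    have h1 := involution_involution hlam (hunit X (rowBall_subset_rowClosedBall hX))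
    have h2 := hV (involutionPerm H hlam ⟨X, hX⟩)
    rw [hΨU, involutionPerm_apply] at h2
    simpa only [h1] using h2.symm
  -- An arbitrary extension is the explicit formula by density, and for that formula the kernel
  -- identity holds directly at boundary points.
  · have hEq : Set.EqOn G (fun X => rowMulMatrix U (involution lam X)) (rowClosedBall H n 1) :=
      Set.EqOn.of_subset_closure (s := rowBall H n 1)
        (fun Z hZ => (hG.2 ⟨Z, hZ⟩).trans (hΨU ⟨Z, hZ⟩)) hG.1 hcont
        rowBall_subset_rowClosedBall rowClosedBall_subset_closure_rowBall
    rw [hEq hX, hEq hY, rowMulStar_rowMulMatrix hU,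
      one_sub_rowMulStar_involution hlam (hunit X hX) (hunit Y hY)]
    simp only [smul_mul_assoc, mul_smul_comm, one_mul, mul_one, smul_smul]
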